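/- Let $n>0$ be a real number, let $\Theta\subseteq\mathbb R^d$ be convex, and let $f\in C^2(\Theta)$ be a convex function with a unique strict global minimizer $\hat\theta\in\Theta$, such that $H=\nabla^2 f(\hat\theta)$ is positive definite. (At points of $\Theta$ on its boundary, derivatives are taken within $\Theta$.) For a vector $u\in\mathbb R^d$ and a matrix $S\in\mathbb R^{d\times d}$ write $|u|_H=|H^{1/2}u|$ and $\|S\|_H=\|H^{-1/2}SH^{-1/2}\|$, where $|\cdot|$ is the Euclidean norm and $\|\cdot\|$ is the corresponding operator norm. Assume that for some $r\ge 6$ the set $$\mathcal U(r)=\Big\{\theta\in\mathbb R^d:\ |\theta-\hat\theta|_H\le r\sqrt{d/n}\Big\}$$ is contained in $\Theta$, put $$\delta_3(r)=\sup_{\theta\in\mathcal U(r),\,\theta\ne\hat\theta}\frac{\|\nabla^2 f(\theta)-\nabla^2 f(\hat\theta)\|_H}{|\theta-\hat\theta|_H}\in[0,\infty],$$ and suppose that $r\,\delta_3(r)\sqrt{d/n}\le \tfrac12$. Then $e^{-nf}$ is integrable on $\Theta$, so that the probability measure $\pi_f$ on $\mathbb R^d$ with density proportional to $e^{-nf}$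 on $\Theta$ (and zero outside $\Theta$) is well-defined, and with $\gamma_f=\mathcal N(\hat\theta,(nH)^{-1})$ we have $$\mathrm{TV}(\pi_f,\gamma_f)\le \frac{\delta_3(r)\,d}{\sqrt{2n}}+3e^{-dr^2/9},$$ where $\mathrm{TV}(\mu,\nu)=\sup_A|\mu(A)-\nu(A)|$, the supremum being over Borel sets $A\subseteq\mathbb R^d$. -/

import Mathlib

open MeasureTheory ProbabilityTheory Matrix
open scoped ENNReal MatrixOrder

namespace LaplaceApprox

variable {d : ℕ}

/-- The weighted Euclidean norm `|u|_A = |A^{1/2} u|` of a vector, for `A` symmetric positive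
definite (`|·|` is the Euclidean norm and `A^{1/2}` the positive semidefinite square root). -/
noncomputable def vecNorm (A : Matrix (Fin d) (Fin d) ℝ) (u : EuclideanSpace ℝ (Fin d)) : ℝ :=
  ‖toEuclideanCLM (𝕜 := ℝ) (CFC.sqrt A) u‖

/-- The weighted operator norm `‖S‖_A = ‖A^{-1/2} S A^{-1/2}‖` of a matrix, for `A` symmetric
positive definite (`‖·‖` is the operator norm with respect to the Euclidean norm). -/
noncomputable def matNorm (A S : Matrix (Fin d) (Fin d) ℝ) : ℝ :=
  ‖toEuclideanCLM (𝕜 := ℝ) ((CFC.sqrt A)⁻¹ * S * (CFC.sqrt A)⁻¹)‖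

/-- The Hessian matrix `∇²f(θ)` of a function `f` on `Θ`. Derivatives are taken within `Θ`: at
interior points of `Θ` these are the usual derivatives, and for a convex `Θ` with nonempty interior
and `f ∈ C²(Θ)` they are the continuous extensions of those at points of `Θ` on its boundary. -/
noncomputable def hessian (f : EuclideanSpace ℝ (Fin d) → ℝ) (Θ : Set (EuclideanSpace ℝ (Fin d)))
    (θ : EuclideanSpace ℝ (Fin d)) : Matrix (Fin d) (Fin d) ℝ :=
  Matrix.of fun i j =>
    iteratedFDerivWithin ℝ 2 f Θ θ
      ![EuclideanSpace.single i (1 : ℝ), EuclideanSpace.single j (1 : ℝ)]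

/-- The ellipsoid `U(r) = {θ ∈ ℝ^d : |θ - c|_H ≤ r √(d/n)}`. -/
noncomputable def ball (H : Matrix (Fin d) (Fin d) ℝ) (c : EuclideanSpace ℝ (Fin d)) (n r : ℝ) :
    Set (EuclideanSpace ℝ (Fin d)) :=
  {θ | vecNorm H (θ - c) ≤ r * √((d : ℝ) / n)}

/-- `δ₃(r) = sup ‖∇²f(θ) - ∇²f(c)‖_H / |θ - c|_H` over `θ ∈ U(r)`, `θ ≠ c`, where `H = ∇²f(c)`.
The supremum is taken in `[0, ∞]`. -/
noncomputable def delta3 (f : EuclideanSpace ℝ (Fin d) → ℝ) (Θ : Set (EuclideanSpace ℝ (Fin d)))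
    (c : EuclideanSpace ℝ (Fin d)) (n r : ℝ) : ℝ≥0∞ :=
  ⨆ θ ∈ ball (hessian f Θ c) c n r \ {c},
    ENNReal.ofReal
      (matNorm (hessian f Θ c) (hessian f Θ θ - hessian f Θ c) / vecNorm (hessian f Θ c) (θ - c))

/-- The measure `π_f` on `ℝ^d` with density proportional to `e^{-n f}` on `Θ` (zero outside `Θ`),
normalized to be a probability measure. -/
noncomputable def gibbs (f : EuclideanSpace ℝ (Fin d) → ℝ) (Θ : Set (EuclideanSpace ℝ (Fin d)))
    (n : ℝ) : Measure (EuclideanSpace ℝ (Fin d)) :=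
  (volume.restrict Θ).tilted fun θ => -(n * f θ)

/-- The Laplace approximation `γ_f = N(c, (n H)⁻¹)`, `H = ∇²f(c)`. -/
noncomputable def laplace (f : EuclideanSpace ℝ (Fin d) → ℝ) (Θ : Set (EuclideanSpace ℝ (Fin d)))
    (c : EuclideanSpace ℝ (Fin d)) (n : ℝ) : Measure (EuclideanSpace ℝ (Fin d)) :=
  multivariateGaussian c (n • hessian f Θ c)⁻¹

/-- The total variation distance `TV(μ, ν) = sup_A |μ(A) - ν(A)|` of two probability measures, the
supremum being over all measurable sets. -/
noncomputable def tvDist {Ω : Type*} [MeasurableSpace Ω] (μ ν : Measure Ω) : ℝ :=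
  ⨆ A : {A : Set Ω // MeasurableSet A}, |μ.real A.1 - ν.real A.1|

end LaplaceApprox

namespace LaplaceApprox

open scoped Pointwise

/-! ### The Prékopa–Leindler inequality -/

/-! Substituting `θ = θhat + n^{-1/2} H^{-1/2} x` turns `γ_f` into the standard Gaussian and `n (f -
f(θhat))` into `V = |x|²/2 + W`. With `η = δ₃/√n`, the definition of `δ₃` reads `‖D²W(x)‖ ≤ η|x|`
for `|x| ≤ r√d`. As `W` and its gradient vanish at `0`, integrating along rays gives `‖DW‖ ≤
η|x|²/2` and `|W| ≤ η|x|³/6`. Everything is compared on the ball of radius `ρ = (2/3) r√d`, where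
`η|x| ≤ 1/3`.

Inside the ball, let `ν ∝ e^{-V}`, `μ ∝ e^{-|x|²/2}` and `G = η²|x|⁴/3`. The key estimate is
`KL(ν|μ) ≤ ∫ G dμ` (`log_integral_le_integral_tilted`, followed by Jensen). It comes from
Prékopa–Leindler with weight `s → 0`, applied to `e^{-V}` and `e^{-|y|²/2 - G}`. To first order in
`s`, its hypothesis is `DW(x)(y-x) - |y-x|²/2 ≤ G(y)`, where the square is the strong convexity of
the Gaussian exponent; this is the scalar inequality `cubic_sub_sq_le`. Since `G` is integrated
against `μ` and not `ν`, only the Gaussian moment `E|x|⁴ = d(d+2) ≤ 3d²` is needed. Pinsker's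
inequality (`sq_measureReal_sub_le`) then gives `√(η²d²/2) = δ₃ d/√(2n)`.

Outside the ball, `V ≥ (4/9)ρ²` on the sphere and `V` is convex with `V(0) = 0`, so `V ≥ (4/9)ρ|x|`
beyond it. Comparison with a product of exponential densities bounds that mass of `π_f` by
`2e^{-dr²/9}`, and a Chernoff bound gives `e^{-dr²/9}` for the Gaussian. The three errors are added
in `standardized_bound`. -/

/-- The translates `K + min L` and `max K + L` both lie in `C` and meet at most in the point `max K
+ min L`. -/
theorem volume_add_volume_le_of_isCompact {K L C : Set ℝ} (hK : IsCompact K) (hL : IsCompact L)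
    (hK' : K.Nonempty) (hL' : L.Nonempty) (h : ∀ a ∈ K, ∀ b ∈ L, a + b ∈ C) :
    volume K + volume L ≤ volume C := by
  set M := sSup K
  set m := sInf L
  have hM : M ∈ K := hK.sSup_mem hK'
  have hm : m ∈ L := hL.sInf_mem hL'
  set K₁ := (fun x => x + (-m)) ⁻¹' K
  set L₁ := (fun x => x + (-M)) ⁻¹' L
  have hsub : K₁ ∪ L₁ ⊆ C := by
    rintro x (hx | hx)
    · simpa using h _ hx _ hm
    · simpa [add_comm, add_assoc] using h _ hM _ hx
  have hdisj : AEDisjoint volume K₁ L₁ := by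
    refine measure_mono_null (t := {M + m}) ?_ (by simp)
    rintro x ⟨hx1, hx2⟩
    have h1 : x + -m ≤ M := le_csSup hK.bddAbove hx1
    have h2 : m ≤ x + -M := csInf_le hL.bddBelow hx2
    simp only [Set.mem_singleton_iff]
    linarith
  have hL₁ : MeasurableSet L₁ := (measurable_add_const _) hL.measurableSet
  calc volume K + volume L = volume K₁ + volume L₁ := by
        rw [measure_preimage_add_right, measure_preimage_add_right]
    _ = volume (K₁ ∪ L₁) := (measure_union₀ hL₁.nullMeasurableSet hdisj).symm
    _ ≤ volume C := measure_mono hsub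

/-- The Brunn–Minkowski inequality on the real line. -/
theorem volume_add_volume_le {A B C : Set ℝ} (hA : MeasurableSet A) (hB : MeasurableSet B)
    (hA' : A.Nonempty) (hB' : B.Nonempty) (h : ∀ a ∈ A, ∀ b ∈ B, a + b ∈ C) :
    volume A + volume B ≤ volume C := by
  obtain ⟨a₀, ha₀⟩ := hA'
  obtain ⟨b₀, hb₀⟩ := hB'
  rw [hA.measure_eq_iSup_isCompact, hB.measure_eq_iSup_isCompact]
  simp only [iSup_and']
  refine ENNReal.biSup_add_biSup_le' ⟨∅, by simp⟩ ⟨∅, by simp⟩ ?_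
  rintro K ⟨hKA, hK⟩ L ⟨hLB, hL⟩
  -- The approximating compact sets may be empty; adjoining a fixed point of each set makes the
  -- compact case applicable.
  calc volume K + volume L ≤ volume (insert a₀ K) + volume (insert b₀ L) :=
        add_le_add (measure_mono (Set.subset_insert _ _)) (measure_mono (Set.subset_insert _ _))
    _ ≤ volume C := by
        refine volume_add_volume_le_of_isCompact (hK.insert _) (hL.insert _) (by simp) (by simp) ?_
        intro a ha b hb
        refine h a ?_ b ?_
        · rcases ha with rfl | ha
          exacts [ha₀, hKA ha]
        · rcases hb with rfl | hb
          exacts [hb₀, hLB hb]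

theorem volume_combo_le {A B C : Set ℝ} (hA : MeasurableSet A) (hB : MeasurableSet B)
    (hA' : A.Nonempty) (hB' : B.Nonempty) {s : ℝ} (hs0 : 0 < s) (hs1 : s < 1)
    (h : ∀ a ∈ A, ∀ b ∈ B, (1 - s) * a + s * b ∈ C) :
    ENNReal.ofReal (1 - s) * volume A + ENNReal.ofReal s * volume B ≤ volume C := by
  have hs1' : 0 < 1 - s := by linarith
  have e1 : volume ((1 - s) • A) = ENNReal.ofReal (1 - s) * volume A := by
    rw [Measure.addHaar_smul]; simp [abs_of_pos hs1']
  have e2 : volume (s • B) = ENNReal.ofReal s * volume B := by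
    rw [Measure.addHaar_smul]; simp [abs_of_pos hs0]
  rw [← e1, ← e2]
  refine volume_add_volume_le (hA.const_smul₀ _) (hB.const_smul₀ _) hA'.smul_set hB'.smul_set ?_
  rintro _ ⟨a, ha, rfl⟩ _ ⟨b, hb, rfl⟩
  exact h a ha b hb

theorem lintegral_eq_lintegral_volume_lt {f : ℝ → ℝ≥0∞} (hf : Measurable f) (h1 : ∀ x, f x ≤ 1) :
    ∫⁻ x, f x = ∫⁻ t in Set.Ioi (0 : ℝ), volume {x | ENNReal.ofReal t < f x} := by
  have hne : ∀ x, f x ≠ ∞ := fun x => ((h1 x).trans_lt ENNReal.one_lt_top).ne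
  have := lintegral_eq_lintegral_meas_lt volume (f := fun x => (f x).toReal)
    (Filter.Eventually.of_forall fun x => ENNReal.toReal_nonneg) hf.ennreal_toReal.aemeasurable
  simp only [ENNReal.ofReal_toReal (hne _)] at this
  rw [this]
  refine setLIntegral_congr_fun measurableSet_Ioi fun t ht => ?_
  congr 1
  ext x
  simp only [Set.mem_ofPred_eq]
  rw [ENNReal.ofReal_lt_iff_lt_toReal (le_of_lt ht) (hne x)]

/-- Layer cake: superlevel sets of `f` and `g` at height `t` combine into that of `h`, so
Brunn–Minkowski applies for each `t`. The common supremum makes both sets nonempty for exactly the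
same heights, which is why the arithmetic mean appears here. -/
theorem prekopaLeindler_real_of_sup_one {f g h : ℝ → ℝ≥0∞} (hf : Measurable f) (hg : Measurable g)
    (hh : Measurable h) {s : ℝ} (hs0 : 0 < s) (hs1 : s < 1)
    (hf1 : ⨆ x, f x = 1) (hg1 : ⨆ x, g x = 1)
    (H : ∀ x y, f x ^ (1 - s) * g y ^ s ≤ h ((1 - s) * x + s * y)) :
    ENNReal.ofReal (1 - s) * (∫⁻ x, f x) + ENNReal.ofReal s * (∫⁻ x, g x) ≤ ∫⁻ x, h x := by
  have hs1' : 0 < 1 - s := by linarith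
  have hf1' : ∀ x, f x ≤ 1 := fun x => hf1 ▸ le_iSup f x
  have hg1' : ∀ x, g x ≤ 1 := fun x => hg1 ▸ le_iSup g x
  -- Heights `t ≥ 1` do not matter, so `h` may be cut at `1`; this gives the finiteness that the
  -- layer cake formula needs.
  set h₁ : ℝ → ℝ≥0∞ := fun x => min (h x) 1
  have hh₁ : Measurable h₁ := hh.min measurable_const
  have hmono : ∀ u : ℝ → ℝ≥0∞, Measurable fun t : ℝ => volume {x | ENNReal.ofReal t < u x} := by
    intro u
    refine Antitone.measurable fun a b hab => measure_mono fun x hx => ?_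
    exact lt_of_le_of_lt (ENNReal.ofReal_le_ofReal hab) hx
  refine le_trans ?_ (lintegral_mono fun x => min_le_left (h x) 1)
  rw [lintegral_eq_lintegral_volume_lt hf hf1', lintegral_eq_lintegral_volume_lt hg hg1',
    lintegral_eq_lintegral_volume_lt hh₁ fun x => min_le_right _ _,
    ← lintegral_const_mul _ (hmono f), ← lintegral_const_mul _ (hmono g),
    ← lintegral_add_left ((hmono f).const_mul _)]
  refine lintegral_mono fun t => ?_
  by_cases ht : ENNReal.ofReal t < 1
  · have hne : ∀ {u : ℝ → ℝ≥0∞}, ⨆ x, u x = 1 → {x | ENNReal.ofReal t < u x}.Nonempty := by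
      intro u hu
      rw [← hu] at ht
      exact lt_iSup_iff.1 ht
    refine volume_combo_le (measurableSet_lt measurable_const hf)
      (measurableSet_lt measurable_const hg) (hne hf1) (hne hg1) hs0 hs1 ?_
    intro a ha b hb
    refine lt_min (lt_of_lt_of_le ?_ (H a b)) ht
    calc ENNReal.ofReal t = ENNReal.ofReal t ^ (1 - s) * ENNReal.ofReal t ^ s := by
          rw [← ENNReal.rpow_add_of_nonneg _ _ hs1'.le hs0.le]; simp
      _ < f a ^ (1 - s) * g b ^ s :=
          ENNReal.mul_lt_mul (ENNReal.rpow_lt_rpow ha hs1') (ENNReal.rpow_lt_rpow hb hs0)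
  · have : ∀ {u : ℝ → ℝ≥0∞}, (∀ x, u x ≤ 1) → {x | ENNReal.ofReal t < u x} = ∅ := by
      intro u hu
      ext x
      simpa using (hu x).trans (not_lt.1 ht)
    simp [this hf1', this hg1']

theorem geom_mean_le_arith_mean {a b : ℝ≥0∞} (ha : a ≠ ∞) (hb : b ≠ ∞) {s : ℝ} (hs0 : 0 < s)
    (hs1 : s < 1) :
    a ^ (1 - s) * b ^ s ≤ ENNReal.ofReal (1 - s) * a + ENNReal.ofReal s * b := by
  lift a to NNReal using ha
  lift b to NNReal using hb
  lift s to NNReal using hs0.le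
  have hs1' : s ≤ 1 := by exact_mod_cast hs1.le
  have := NNReal.geom_mean_le_arith_mean2_weighted (1 - s) s a b (tsub_add_cancel_of_le hs1')
  have e : ((1 : ℝ) - s) = ((1 - s : NNReal) : ℝ) := by rw [NNReal.coe_sub hs1']; simp
  rw [e, ENNReal.ofReal_coe_nnreal, ENNReal.ofReal_coe_nnreal,
    ← ENNReal.coe_rpow_of_nonneg _ (NNReal.coe_nonneg _),
    ← ENNReal.coe_rpow_of_nonneg _ (NNReal.coe_nonneg _)]
  exact_mod_cast this

theorem prekopaLeindler_real_of_bounded {f g h : ℝ → ℝ≥0∞} (hf : Measurable f) (hg : Measurable g)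
    (hh : Measurable h) {s : ℝ} (hs0 : 0 < s) (hs1 : s < 1)
    (hf1 : ⨆ x, f x ≠ ∞) (hg1 : ⨆ x, g x ≠ ∞)
    (H : ∀ x y, f x ^ (1 - s) * g y ^ s ≤ h ((1 - s) * x + s * y)) :
    (∫⁻ x, f x) ^ (1 - s) * (∫⁻ x, g x) ^ s ≤ ∫⁻ x, h x := by
  have hs1' : 0 < 1 - s := by linarith
  set a := ⨆ x, f x
  set b := ⨆ x, g x
  by_cases ha : a = 0
  · have : ∀ x, f x = 0 := fun x => le_antisymm (ha ▸ le_iSup f x) bot_le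
    simp [this, hs1']
  by_cases hb : b = 0
  · have : ∀ x, g x = 0 := fun x => le_antisymm (hb ▸ le_iSup g x) bot_le
    simp [this, hs0]
  -- Dividing `f`, `g`, `h` by `a`, `b`, `c` preserves the hypothesis and normalizes both suprema to
  -- `1`; the weighted AM–GM inequality then returns the homogeneous form.
  set c := a ^ (1 - s) * b ^ s
  have hc0 : c ≠ 0 := by
    simp only [c, ne_eq, mul_eq_zero, ENNReal.rpow_eq_zero_iff, not_or]
    exact ⟨by simp [ha, hf1], by simp [hb, hg1]⟩
  have hc1 : c ≠ ∞ :=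
    ENNReal.mul_ne_top (ENNReal.rpow_ne_top_of_nonneg hs1'.le hf1)
      (ENNReal.rpow_ne_top_of_nonneg hs0.le hg1)
  have hcinv : c⁻¹ = (a⁻¹) ^ (1 - s) * (b⁻¹) ^ s := by
    rw [ENNReal.mul_inv, ENNReal.inv_rpow, ENNReal.inv_rpow]
    · right; exact ENNReal.rpow_ne_top_of_nonneg hs0.le hg1
    · left; exact ENNReal.rpow_ne_top_of_nonneg hs1'.le hf1
  have key := prekopaLeindler_real_of_sup_one (f := fun x => a⁻¹ * f x) (g := fun x => b⁻¹ * g x)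
    (h := fun x => c⁻¹ * h x) (hf.const_mul _) (hg.const_mul _) (hh.const_mul _) hs0 hs1
    (by rw [← ENNReal.mul_iSup]; exact ENNReal.inv_mul_cancel ha hf1)
    (by rw [← ENNReal.mul_iSup]; exact ENNReal.inv_mul_cancel hb hg1) (by
      intro x y
      rw [ENNReal.mul_rpow_of_nonneg _ _ hs1'.le, ENNReal.mul_rpow_of_nonneg _ _ hs0.le,
        mul_mul_mul_comm, ← hcinv]
      exact mul_le_mul_right (H x y) _)
  simp only [lintegral_const_mul, hf, hg, hh] at key
  by_cases hhtop : ∫⁻ x, h x = ∞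
  · simp [hhtop]
  have hRtop : c⁻¹ * ∫⁻ x, h x ≠ ∞ := ENNReal.mul_ne_top (ENNReal.inv_ne_top.2 hc0) hhtop
  have hLtop := ne_top_of_le_ne_top hRtop key
  have hF : a⁻¹ * ∫⁻ x, f x ≠ ∞ := by
    intro h'
    rw [h', ENNReal.mul_top (by simpa using hs1), top_add] at hLtop
    simp at hLtop
  have hG : b⁻¹ * ∫⁻ x, g x ≠ ∞ := by
    intro h'
    rw [h', ENNReal.mul_top (by simpa using hs0), add_top] at hLtop
    simp at hLtop
  have h2 := (geom_mean_le_arith_mean hF hG hs0 hs1).trans key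
  rw [ENNReal.mul_rpow_of_nonneg _ _ hs1'.le, ENNReal.mul_rpow_of_nonneg _ _ hs0.le,
    mul_mul_mul_comm, ← hcinv] at h2
  exact (ENNReal.mul_le_mul_iff_right (ENNReal.inv_ne_zero.2 hc1) (ENNReal.inv_ne_top.2 hc0)).1 h2

theorem tendsto_lintegral_min_nat {α : Type*} [MeasurableSpace α] {μ : Measure α} {f : α → ℝ≥0∞}
    (hf : Measurable f) :
    Filter.Tendsto (fun N : ℕ => ∫⁻ x, min (f x) N ∂μ) Filter.atTop (nhds (∫⁻ x, f x ∂μ)) := by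
  refine lintegral_tendsto_of_tendsto_of_monotone (fun N => (hf.min measurable_const).aemeasurable)
    (Filter.Eventually.of_forall fun x N M hNM => min_le_min le_rfl (by exact_mod_cast hNM))
    (Filter.Eventually.of_forall fun x => ?_)
  have : Filter.Tendsto (fun N : ℕ => min (f x) (N : ℝ≥0∞)) Filter.atTop (nhds (min (f x) ∞)) :=
    tendsto_const_nhds.min ENNReal.tendsto_nat_nhds_top
  simpa using this

/-- The Prékopa–Leindler inequality on the real line. -/
theorem prekopaLeindler_real {f g h : ℝ → ℝ≥0∞} (hf : Measurable f) (hg : Measurable g)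
    (hh : Measurable h) {s : ℝ} (hs0 : 0 < s) (hs1 : s < 1)
    (H : ∀ x y, f x ^ (1 - s) * g y ^ s ≤ h ((1 - s) * x + s * y)) :
    (∫⁻ x, f x) ^ (1 - s) * (∫⁻ x, g x) ^ s ≤ ∫⁻ x, h x := by
  have hs1' : 0 < 1 - s := by linarith
  have hstep : ∀ N M : ℕ,
      (∫⁻ x, min (f x) N) ^ (1 - s) * (∫⁻ x, min (g x) M) ^ s ≤ ∫⁻ x, h x := by
    intro N M
    refine prekopaLeindler_real_of_bounded (hf.min measurable_const) (hg.min measurable_const) hh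
      hs0 hs1 (ne_top_of_le_ne_top (ENNReal.natCast_ne_top N) (iSup_le fun x => min_le_right _ _))
      (ne_top_of_le_ne_top (ENNReal.natCast_ne_top M) (iSup_le fun x => min_le_right _ _)) ?_
    intro x y
    exact (mul_le_mul' (ENNReal.rpow_le_rpow (min_le_left _ _) hs1'.le)
      (ENNReal.rpow_le_rpow (min_le_left _ _) hs0.le)).trans (H x y)
  have mono : ∀ {u : ℝ → ℝ≥0∞} {N M : ℕ}, N ≤ M →
      ∫⁻ x, min (u x) N ≤ ∫⁻ x, min (u x) M := fun hNM =>
    lintegral_mono fun x => min_le_min le_rfl (by exact_mod_cast hNM)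
  have sup : ∀ {u : ℝ → ℝ≥0∞}, Measurable u →
      ∫⁻ x, u x = ⨆ N : ℕ, ∫⁻ x, min (u x) N := fun hu =>
    tendsto_nhds_unique (tendsto_lintegral_min_nat hu)
      (tendsto_atTop_iSup fun N M hNM => mono hNM)
  have powSup : ∀ {u : ℕ → ℝ≥0∞} {p : ℝ}, 0 < p → (⨆ N, u N) ^ p = ⨆ N, u N ^ p := fun hp =>
    (ENNReal.orderIsoRpow _ hp).map_iSup _
  rw [sup hf, sup hg, powSup hs1', powSup hs0]
  rw [ENNReal.iSup_mul]
  refine iSup_le fun N => ?_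
  rw [ENNReal.mul_iSup]
  exact iSup_le fun M => hstep N M

/-- The Prékopa–Leindler inequality on `Fin d → ℝ`. -/
theorem prekopaLeindler_pi {s : ℝ} (hs0 : 0 < s) (hs1 : s < 1) :
    ∀ (d : ℕ) {f g h : (Fin d → ℝ) → ℝ≥0∞}, Measurable f → Measurable g → Measurable h →
    (∀ x y, f x ^ (1 - s) * g y ^ s ≤ h ((1 - s) • x + s • y)) →
    (∫⁻ x, f x) ^ (1 - s) * (∫⁻ x, g x) ^ s ≤ ∫⁻ x, h x
  | 0, f, g, h, hf, hg, hh, H => by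
    have e : ∀ u : (Fin 0 → ℝ) → ℝ≥0∞, ∫⁻ x, u x = u 0 := by
      intro u
      rw [lintegral_unique]
      simp only [volume_pi, Measure.pi_univ, Finset.univ_eq_empty, Finset.prod_empty, mul_one]
      exact congrArg u (Subsingleton.elim _ _)
    rw [e, e, e]
    simpa using H 0 0
  | d + 1, f, g, h, hf, hg, hh, H => by
    -- Tensorization: the inequality in dimension `d` for the sections at `t` and `t'` is the
    -- hypothesis of the one-dimensional inequality for the marginals.
    set e := (MeasurableEquiv.piFinSuccAbove (fun _ : Fin (d + 1) => ℝ) 0).symm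
    have he : MeasurePreserving e :=
      (volume_preserving_piFinSuccAbove (fun _ : Fin (d + 1) => ℝ) 0).symm _
    have lin : ∀ (t t' : ℝ) (x x' : Fin d → ℝ),
        (1 - s) • e (t, x) + s • e (t', x') =
          e ((1 - s) * t + s * t', (1 - s) • x + s • x') := by
      intro t t' x x'
      ext i
      refine Fin.cases ?_ (fun i => ?_) i <;>
        simp [e, MeasurableEquiv.piFinSuccAbove, Fin.insertNthEquiv]
    have fub : ∀ {u : (Fin (d + 1) → ℝ) → ℝ≥0∞}, Measurable u →
        ∫⁻ x, u x = ∫⁻ t : ℝ, ∫⁻ x : Fin d → ℝ, u (e (t, x)) := by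
      intro u hu
      rw [← he.lintegral_comp_emb e.measurableEmbedding, Measure.volume_eq_prod,
        lintegral_prod (fun z => u (e z)) (hu.comp e.measurable).aemeasurable]
    have meas : ∀ {u : (Fin (d + 1) → ℝ) → ℝ≥0∞}, Measurable u →
        Measurable fun t : ℝ => ∫⁻ x : Fin d → ℝ, u (e (t, x)) := fun hu =>
      (hu.comp e.measurable).lintegral_prod_right'
    have sec : ∀ {u : (Fin (d + 1) → ℝ) → ℝ≥0∞}, Measurable u → ∀ t : ℝ,
        Measurable fun x : Fin d → ℝ => u (e (t, x)) := fun hu t =>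
      hu.comp (e.measurable.comp measurable_prodMk_left)
    rw [fub hf, fub hg, fub hh]
    refine prekopaLeindler_real (meas hf) (meas hg) (meas hh) hs0 hs1 fun t t' => ?_
    refine prekopaLeindler_pi hs0 hs1 d (sec hf t) (sec hg t') (sec hh _) fun x x' => ?_
    rw [← lin]
    exact H _ _

/-- The Prékopa–Leindler inequality on Euclidean space. -/
theorem prekopaLeindler {d : ℕ} {f g h : EuclideanSpace ℝ (Fin d) → ℝ≥0∞} (hf : Measurable f)
    (hg : Measurable g) (hh : Measurable h) {s : ℝ} (hs0 : 0 < s) (hs1 : s < 1)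
    (H : ∀ x y, f x ^ (1 - s) * g y ^ s ≤ h ((1 - s) • x + s • y)) :
    (∫⁻ x, f x) ^ (1 - s) * (∫⁻ x, g x) ^ s ≤ ∫⁻ x, h x := by
  have he := PiLp.volume_preserving_toLp (Fin d)
  have hm : Measurable (WithLp.toLp 2 : (Fin d → ℝ) → EuclideanSpace ℝ (Fin d)) := he.measurable
  rw [← he.lintegral_comp hf, ← he.lintegral_comp hg, ← he.lintegral_comp hh]
  exact prekopaLeindler_pi hs0 hs1 d (hf.comp hm) (hg.comp hm) (hh.comp hm) fun x y => H _ _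

variable {d : ℕ}

/-! ### An entropy bound for perturbed Gaussian measures on a ball -/

/-- The scale-free form of the hard case of `cubic_sub_sq_le`, with `h = ηb` and `x = p/b`. -/
theorem quartic_nonneg {h x : ℝ} (hh : h ≤ 1 / 3) (hx1 : x ≤ 1) :
    0 ≤ 2 * h ^ 2 * (1 - x) ^ 4 - 3 * h * x + 3 * x ^ 2 := by
  have tangent : ∀ y c : ℝ, 0 ≤ y → 0 ≤ c → 4 * c ^ 3 * y - 3 * c ^ 4 ≤ y ^ 4 := by
    intro y c hy hc
    have : 0 ≤ (y - c) ^ 2 * (y ^ 2 + 2 * c * y + 3 * c ^ 2) := by positivity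
    nlinarith
  -- The threshold lies just below the root of `(1-x)⁴ = 3/8`. Up to it the expression dominates
  -- `(3/4)(h-2x)²`; beyond it the value at `h` is at least the value at `h = 1/3`, by the
  -- factorization `h3`.
  rcases le_total x (217 / 1000) with hx | hx
  · have h1 : (783 / 1000 : ℝ) ^ 4 ≤ (1 - x) ^ 4 :=
      pow_le_pow_left₀ (by norm_num) (by linarith) 4
    have h2 : (3 / 8 : ℝ) ≤ (1 - x) ^ 4 := le_trans (by norm_num) h1
    have h3 := mul_le_mul_of_nonneg_left h2 (by positivity : 0 ≤ 2 * h ^ 2)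
    nlinarith [sq_nonneg (h - 2 * x)]
  · have h1 : (1 - x) ^ 4 ≤ (783 / 1000 : ℝ) ^ 4 :=
      pow_le_pow_left₀ (by linarith) (by linarith) 4
    -- At `h = 1/3`, replacing the quartic by its tangent at `0.77` leaves a positive quadratic with
    -- minimum near `x = 117/500`.
    have h2 := tangent (1 - x) (77 / 100) (by linarith) (by norm_num)
    have h3 : 0 ≤ (1 / 3 - h) * (3 * x - 2 * (h + 1 / 3) * (1 - x) ^ 4) := by
      refine mul_nonneg (by linarith) ?_
      have : 2 * (h + 1 / 3) * (1 - x) ^ 4 ≤ 4 / 3 * (783 / 1000 : ℝ) ^ 4 :=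
        mul_le_mul (by linarith) h1 (by positivity) (by norm_num)
      norm_num at this
      linarith
    have h4 : 0 ≤ 2 * (1 - x) ^ 4 - 9 * x + 27 * x ^ 2 := by
      nlinarith [sq_nonneg (x - 117 / 500)]
    nlinarith

/-- Used with `b = |x|`, `a = |y|`, `p = |y - x|`. Young's inequality alone gives `η²b⁴/8`; the
larger constant `1/3` pays for having `a` in place of `b`. For `b ≤ p` the left side is nonpositive
because `ηb² ≤ b/3`. -/
theorem cubic_sub_sq_le {η a b p : ℝ} (hb : 0 ≤ b) (hp : 0 ≤ p)
    (hab : b ≤ a + p) (hηb : η * b ≤ 1 / 3) :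
    η * b ^ 2 * p / 2 - p ^ 2 / 2 ≤ η ^ 2 * a ^ 4 / 3 := by
  have hR : 0 ≤ η ^ 2 * a ^ 4 / 3 := by positivity
  rcases le_total b a with hba | hba
  · have : b ^ 4 ≤ a ^ 4 := pow_le_pow_left₀ hb hba 4
    have h2 := mul_le_mul_of_nonneg_left this (by positivity : 0 ≤ η ^ 2)
    nlinarith [sq_nonneg (η * b ^ 2 - 2 * p), hR]
  rcases hb.eq_or_lt with rfl | hb'
  · nlinarith [sq_nonneg p]
  rcases le_total b p with hbp | hbp
  · have : η * b ^ 2 * p ≤ p * p := by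
      refine mul_le_mul_of_nonneg_right ?_ hp
      nlinarith
    nlinarith
  · have hq := quartic_nonneg (x := p / b) hηb (by rwa [div_le_one hb'])
    have e : 2 * (η * b) ^ 2 * (1 - p / b) ^ 4 - 3 * (η * b) * (p / b) + 3 * (p / b) ^ 2 =
        (2 * η ^ 2 * (b - p) ^ 4 - 3 * η * b ^ 2 * p + 3 * p ^ 2) / b ^ 2 := by
      field_simp
    rw [e] at hq
    have h3 : 0 ≤ 2 * η ^ 2 * (b - p) ^ 4 - 3 * η * b ^ 2 * p + 3 * p ^ 2 := by
      by_contra hneg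
      exact absurd (div_neg_of_neg_of_pos (not_le.1 hneg) (by positivity : 0 < b ^ 2)) (not_lt.2 hq)
    have h4 : (b - p) ^ 4 ≤ a ^ 4 := pow_le_pow_left₀ (by linarith) (by linarith) 4
    have h5 := mul_le_mul_of_nonneg_left h4 (by positivity : 0 ≤ η ^ 2)
    linarith

section Perturbation

variable {W : EuclideanSpace ℝ (Fin d) → ℝ}
  {W' : EuclideanSpace ℝ (Fin d) → EuclideanSpace ℝ (Fin d) →L[ℝ] ℝ} {η ρ L : ℝ}

theorem taylor_one_le {B : Set (EuclideanSpace ℝ (Fin d))} (hB : Convex ℝ B)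
    (hW : ∀ x ∈ B, HasFDerivAt W (W' x) x) (hL : 0 ≤ L)
    (h2 : ∀ x ∈ B, ∀ y ∈ B, ‖W' x - W' y‖ ≤ L * ‖x - y‖) {x z : EuclideanSpace ℝ (Fin d)}
    (hx : x ∈ B) (hz : z ∈ B) :
    W z - W x - W' x (z - x) ≤ L * ‖z - x‖ ^ 2 := by
  have hseg : segment ℝ x z ⊆ B := hB.segment_subset hx hz
  have := (convex_segment x z).norm_image_sub_le_of_norm_hasFDerivWithin_le' (f := W) (f' := W')
    (φ := W' x) (C := L * ‖z - x‖) (fun w hw => (hW w (hseg hw)).hasFDerivWithinAt) (fun w hw => by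
      refine (h2 w (hseg hw) x hx).trans (mul_le_mul_of_nonneg_left ?_ hL)
      rw [segment_eq_image'] at hw
      obtain ⟨t, ht, rfl⟩ := hw
      simp only [add_sub_cancel_left, norm_smul, Real.norm_eq_abs, abs_of_nonneg ht.1]
      exact mul_le_of_le_one_left (norm_nonneg _) ht.2)
    (left_mem_segment ℝ x z) (right_mem_segment ℝ x z)
  calc _ ≤ ‖W z - W x - W' x (z - x)‖ := le_abs_self _
    _ ≤ _ := this
    _ = _ := by ring

/-- The hypothesis of Prékopa–Leindler. The identity for `‖(1-s)x + sy‖²` gains `s(1-s)‖y-x‖²/2`,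
which absorbs the first-order Taylor term of `W` up to `s η²‖y‖⁴/3`. The Taylor remainder is
`O(s²)`, using `‖y-x‖ ≤ 2ρ`. -/
theorem combo_exponent_le (hη : 0 ≤ η) (hηρ : η * ρ ≤ 1 / 3) (hL : 0 ≤ L)
    (hW : ∀ x ∈ Metric.closedBall 0 ρ, HasFDerivAt W (W' x) x)
    (h1 : ∀ x ∈ Metric.closedBall 0 ρ, ‖W' x‖ ≤ η * ‖x‖ ^ 2 / 2)
    (h2 : ∀ x ∈ Metric.closedBall 0 ρ, ∀ y ∈ Metric.closedBall 0 ρ,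
      ‖W' x - W' y‖ ≤ L * ‖x - y‖)
    {x y : EuclideanSpace ℝ (Fin d)} (hx : x ∈ Metric.closedBall 0 ρ)
    (hy : y ∈ Metric.closedBall 0 ρ) {s : ℝ} (hs0 : 0 < s) (hs1 : s < 1) :
    (1 - s) * -(‖x‖ ^ 2 / 2 + W x) + s * -(‖y‖ ^ 2 / 2 + η ^ 2 * ‖y‖ ^ 4 / 3) ≤
      -(‖(1 - s) • x + s • y‖ ^ 2 / 2 + W ((1 - s) • x + s • y)) + s * W ((1 - s) • x + s • y)
        + 4 * L * ρ ^ 2 * s ^ 2 := by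
  have hz : (1 - s) • x + s • y ∈ Metric.closedBall (0 : EuclideanSpace ℝ (Fin d)) ρ :=
    convex_closedBall 0 ρ hx hy (by linarith) hs0.le (by ring)
  have hzx : (1 - s) • x + s • y - x = s • (y - x) := by module
  have hT := taylor_one_le (convex_closedBall 0 ρ) hW hL h2 hx hz
  have hx' : ‖x‖ ≤ ρ := by simpa using hx
  have hy' : ‖y‖ ≤ ρ := by simpa using hy
  have hn : ‖(1 - s) • x + s • y‖ ^ 2 =
      (1 - s) * ‖x‖ ^ 2 + s * ‖y‖ ^ 2 - s * (1 - s) * ‖y - x‖ ^ 2 := by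
    rw [@norm_add_sq_real, norm_sub_sq_real, real_inner_smul_left, real_inner_smul_right,
      norm_smul, norm_smul, Real.norm_eq_abs, Real.norm_eq_abs, mul_pow, mul_pow, sq_abs, sq_abs,
      real_inner_comm x y]
    ring
  set z := (1 - s) • x + s • y
  rw [hzx, map_smul, norm_smul, smul_eq_mul, Real.norm_eq_abs, abs_of_pos hs0] at hT
  set p := y - x
  have hpx : ‖x‖ ≤ ‖y‖ + ‖p‖ := by
    have := norm_sub_le y p
    simpa [p] using this
  have hp2 : ‖p‖ ≤ 2 * ρ := by
    have := norm_sub_le y x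
    simp only [p]; linarith
  have hdir : W' x p - ‖p‖ ^ 2 / 2 ≤ η ^ 2 * ‖y‖ ^ 4 / 3 := by
    have hc := cubic_sub_sq_le (norm_nonneg x) (norm_nonneg p) hpx
      ((mul_le_mul_of_nonneg_left hx' hη).trans hηρ)
    have : W' x p ≤ η * ‖x‖ ^ 2 / 2 * ‖p‖ :=
      (le_abs_self _).trans (((W' x).le_opNorm p).trans
        (mul_le_mul_of_nonneg_right (h1 x hx) (norm_nonneg _)))
    linarith
  have hG : 0 ≤ η ^ 2 * ‖y‖ ^ 4 / 3 := by positivity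
  have hp4 : ‖p‖ ^ 2 ≤ 4 * ρ ^ 2 := by
    have := pow_le_pow_left₀ (norm_nonneg p) hp2 2
    linarith
  rw [hn]
  have a1 : s * (1 - s) * (W' x p - ‖p‖ ^ 2 / 2) ≤ s * (1 - s) * (η ^ 2 * ‖y‖ ^ 4 / 3) :=
    mul_le_mul_of_nonneg_left hdir (mul_nonneg hs0.le (by linarith))
  have a2 : s * s * (η ^ 2 * ‖y‖ ^ 4 / 3) ≥ 0 := by positivity
  have a3 : (1 - s) * (W z - W x) ≤ (1 - s) * (s * W' x p + L * (s * ‖p‖) ^ 2) :=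
    mul_le_mul_of_nonneg_left (by linarith) (by linarith)
  have a4 : (1 - s) * (L * (s * ‖p‖) ^ 2) ≤ 4 * L * ρ ^ 2 * s ^ 2 := by
    have : 0 ≤ L * (s * ‖p‖) ^ 2 := by positivity
    have b1 : (1 - s) * (L * (s * ‖p‖) ^ 2) ≤ L * (s * ‖p‖) ^ 2 :=
      mul_le_of_le_one_left this (by linarith)
    have b2 : L * s ^ 2 * ‖p‖ ^ 2 ≤ L * s ^ 2 * (4 * ρ ^ 2) :=
      mul_le_mul_of_nonneg_left hp4 (by positivity)
    nlinarith
  nlinarith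

/-- A real-valued form of the Prékopa–Leindler inequality on a compact set. -/
theorem prekopaLeindler_exp {B : Set (EuclideanSpace ℝ (Fin d))} (hB : IsCompact B)
    (hBc : Convex ℝ B) {u v w : EuclideanSpace ℝ (Fin d) → ℝ} (hu : ContinuousOn u B)
    (hv : ContinuousOn v B) (hw : ContinuousOn w B) {s : ℝ} (hs0 : 0 < s) (hs1 : s < 1)
    (H : ∀ x ∈ B, ∀ y ∈ B, (1 - s) * u x + s * v y ≤ w ((1 - s) • x + s • y)) :
    (∫ x in B, Real.exp (u x)) ^ (1 - s) * (∫ x in B, Real.exp (v x)) ^ s ≤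
      ∫ x in B, Real.exp (w x) := by
  classical
  have hs1' : 0 < 1 - s := by linarith
  have hBm := hB.measurableSet
  have meas : ∀ {u : EuclideanSpace ℝ (Fin d) → ℝ}, ContinuousOn u B →
      Measurable (B.indicator fun x => ENNReal.ofReal (Real.exp (u x))) := by
    intro u hu
    rw [← Set.piecewise_eq_indicator]
    refine ContinuousOn.measurable_piecewise ?_ continuousOn_const hBm
    exact ENNReal.continuous_ofReal.comp_continuousOn (Real.continuous_exp.comp_continuousOn hu)
  have lint : ∀ {u : EuclideanSpace ℝ (Fin d) → ℝ}, ContinuousOn u B →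
      ∫⁻ x, B.indicator (fun x => ENNReal.ofReal (Real.exp (u x))) x =
        ENNReal.ofReal (∫ x in B, Real.exp (u x)) := by
    intro u hu
    rw [lintegral_indicator hBm, ofReal_integral_eq_lintegral_ofReal]
    · exact (Real.continuous_exp.comp_continuousOn hu).integrableOn_compact hB
    · exact Filter.Eventually.of_forall fun x => (Real.exp_pos _).le
  have key := prekopaLeindler (meas hu) (meas hv) (meas hw) hs0 hs1 (by
    intro x y
    by_cases hx : x ∈ B
    · by_cases hy : y ∈ B
      · rw [Set.indicator_of_mem hx, Set.indicator_of_mem hy,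
          Set.indicator_of_mem (hBc hx hy hs1'.le hs0.le (by ring)),
          ENNReal.ofReal_rpow_of_pos (Real.exp_pos _), ENNReal.ofReal_rpow_of_pos (Real.exp_pos _),
          ← ENNReal.ofReal_mul (by positivity), ← Real.exp_mul, ← Real.exp_mul, ← Real.exp_add]
        refine ENNReal.ofReal_le_ofReal (Real.exp_le_exp.2 ?_)
        linarith [H x hx y hy]
      · simp [Set.indicator_of_notMem hy, hs0]
    · simp [Set.indicator_of_notMem hx, hs1'])
  have nn : ∀ u : EuclideanSpace ℝ (Fin d) → ℝ, 0 ≤ ∫ x in B, Real.exp (u x) := fun u =>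
    integral_nonneg fun x => (Real.exp_pos _).le
  rw [lint hu, lint hv, lint hw, ENNReal.ofReal_rpow_of_nonneg (nn _) hs1'.le,
    ENNReal.ofReal_rpow_of_nonneg (nn _) hs0.le,
    ← ENNReal.ofReal_mul (Real.rpow_nonneg (nn _) _)] at key
  exact (ENNReal.ofReal_le_ofReal_iff (nn _)).1 key

theorem le_of_forall_small_add {a b c δ : ℝ} (hδ : 0 < δ)
    (h : ∀ s, 0 < s → s < δ → a ≤ b + s * c) : a ≤ b := by
  have ht : Filter.Tendsto (fun s : ℝ => b + s * c) (nhdsWithin 0 (Set.Ioi 0)) (nhds b) := by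
    have : Filter.Tendsto (fun s : ℝ => b + s * c) (nhds 0) (nhds (b + 0 * c)) :=
      (by fun_prop : Continuous fun s : ℝ => b + s * c).tendsto 0
    simpa using this.mono_left nhdsWithin_le_nhds
  refine ge_of_tendsto ht ?_
  filter_upwards [Ioo_mem_nhdsGT hδ] with s hs using h s hs.1 hs.2

/-- The derivative at `s = 0` of the logarithmic Prékopa–Leindler inequality: both sides agree at `s
= 0`, and dividing by `s` and letting `s → 0` removes all second-order terms, including the
Lipschitz constant `L`. -/
theorem log_integral_le_integral_tilted (hρ : 0 < ρ) (hη : 0 ≤ η) (hηρ : η * ρ ≤ 1 / 3)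
    (hL : 0 ≤ L)
    (hW : ∀ x ∈ Metric.closedBall 0 ρ, HasFDerivAt W (W' x) x)
    (h1 : ∀ x ∈ Metric.closedBall 0 ρ, ‖W' x‖ ≤ η * ‖x‖ ^ 2 / 2)
    (h2 : ∀ x ∈ Metric.closedBall 0 ρ, ∀ y ∈ Metric.closedBall 0 ρ,
      ‖W' x - W' y‖ ≤ L * ‖x - y‖) :
    Real.log (∫ x in Metric.closedBall (0 : EuclideanSpace ℝ (Fin d)) ρ,
        Real.exp (-(‖x‖ ^ 2 / 2 + η ^ 2 * ‖x‖ ^ 4 / 3))) -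
      Real.log (∫ x in Metric.closedBall (0 : EuclideanSpace ℝ (Fin d)) ρ,
        Real.exp (-(‖x‖ ^ 2 / 2 + W x))) ≤
      ∫ x, W x ∂((volume.restrict (Metric.closedBall (0 : EuclideanSpace ℝ (Fin d)) ρ)).tilted
        fun x => -(‖x‖ ^ 2 / 2 + W x)) := by
  set B := Metric.closedBall (0 : EuclideanSpace ℝ (Fin d)) ρ
  have hB : IsCompact B := isCompact_closedBall 0 ρ
  have hWc : ContinuousOn W B := fun x hx => (hW x hx).continuousAt.continuousWithinAt
  have hBpos : 0 < volume B := Metric.measure_closedBall_pos _ _ hρ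
  have hne : NeZero (volume.restrict B) := ⟨by
    rw [Ne, Measure.restrict_eq_zero]; exact hBpos.ne'⟩
  have hVc : ContinuousOn (fun x => -(‖x‖ ^ 2 / 2 + W x)) B := by fun_prop
  have hGc : ContinuousOn (fun x : EuclideanSpace ℝ (Fin d) =>
      -(‖x‖ ^ 2 / 2 + η ^ 2 * ‖x‖ ^ 4 / 3)) B := by fun_prop
  have int : ∀ {u : EuclideanSpace ℝ (Fin d) → ℝ}, ContinuousOn u B →
      Integrable (fun x => Real.exp (u x)) (volume.restrict B) := fun hu =>
    (Real.continuous_exp.comp_continuousOn hu).integrableOn_compact hB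
  have hZ : 0 < ∫ x in B, Real.exp (-(‖x‖ ^ 2 / 2 + W x)) := integral_exp_pos (int hVc)
  have hI : 0 < ∫ x in B, Real.exp (-(‖x‖ ^ 2 / 2 + η ^ 2 * ‖x‖ ^ 4 / 3)) :=
    integral_exp_pos (int hGc)
  set ν := (volume.restrict B).tilted fun x => -(‖x‖ ^ 2 / 2 + W x)
  have hν : IsProbabilityMeasure ν := isProbabilityMeasure_tilted (int hVc)
  obtain ⟨M, hM⟩ := hB.exists_bound_of_continuousOn hWc
  have hM0 : 0 ≤ M := (norm_nonneg _).trans (hM 0 (by simp [B, hρ.le]))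
  have intν : ∀ {u : EuclideanSpace ℝ (Fin d) → ℝ}, ContinuousOn u B → Integrable u ν := by
    intro u hu
    rw [integrable_tilted_iff (int hVc)]
    exact ((Real.continuous_exp.comp_continuousOn hVc).smul hu).integrableOn_compact hB
  have aeB : ∀ᵐ x ∂ν, x ∈ B :=
    (tilted_absolutelyContinuous _ _).ae_le (ae_restrict_mem hB.measurableSet)
  -- The error collects the `s²` term of `combo_exponent_le` and that of `e^{sW} ≤ 1 + sW + s²M²`.
  -- The range of `s` ensures `|sW| ≤ 1`, as the exponential bound requires.
  refine le_of_forall_small_add (c := 4 * L * ρ ^ 2 + M ^ 2) (δ := 1 / (M + 1)) (by positivity) ?_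
  intro s hs0 hs1
  have hsM : s * (M + 1) < 1 := by rwa [lt_div_iff₀ (by positivity)] at hs1
  have hs1' : s < 1 := by nlinarith
  have key := prekopaLeindler_exp hB (convex_closedBall 0 ρ) hVc hGc
    (w := fun z => -(‖z‖ ^ 2 / 2 + W z) + s * W z + 4 * L * ρ ^ 2 * s ^ 2)
    (by fun_prop) hs0 hs1'
    (fun x hx y hy => combo_exponent_le hη hηρ hL hW h1 h2 hx hy hs0 hs1')
  have e1 : ∫ z in B, Real.exp (-(‖z‖ ^ 2 / 2 + W z) + s * W z + 4 * L * ρ ^ 2 * s ^ 2) =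
      Real.exp (4 * L * ρ ^ 2 * s ^ 2) *
        ((∫ x in B, Real.exp (-(‖x‖ ^ 2 / 2 + W x))) * ∫ x, Real.exp (s * W x) ∂ν) := by
    rw [integral_exp_tilted, mul_div_cancel₀ _ hZ.ne', ← integral_const_mul]
    congr 1
    ext z
    simp only [Pi.add_apply]
    rw [Real.exp_add, mul_comm]
  have e2 : ∫ x, Real.exp (s * W x) ∂ν ≤ 1 + s * (∫ x, W x ∂ν) + s ^ 2 * M ^ 2 := by
    have : ∫ x, (1 + s * W x + s ^ 2 * M ^ 2) ∂ν = 1 + s * (∫ x, W x ∂ν) + s ^ 2 * M ^ 2 := by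
      rw [integral_add (intν (by fun_prop)) (intν (by fun_prop)),
        integral_add (intν (by fun_prop)) (intν (by fun_prop)), integral_const_mul]
      simp
    rw [← this]
    refine integral_mono_ae (intν (by fun_prop)) (intν (by fun_prop)) ?_
    filter_upwards [aeB] with x hx
    have hWx : |W x| ≤ M := hM x hx
    have hsW : |s * W x| ≤ 1 := by
      rw [abs_mul, abs_of_pos hs0]
      nlinarith
    have := (abs_le.1 (Real.abs_exp_sub_one_sub_id_le hsW)).2
    have h3 : (s * W x) ^ 2 ≤ s ^ 2 * M ^ 2 := by
      rw [mul_pow]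
      exact mul_le_mul_of_nonneg_left (sq_le_sq' (by linarith [abs_le.1 hWx]) (abs_le.1 hWx).2)
        (by positivity)
    linarith
  have hE : 0 < ∫ x, Real.exp (s * W x) ∂ν := integral_exp_pos (intν (by fun_prop))
  rw [e1] at key
  have l := Real.log_le_log (by positivity) key
  rw [Real.log_mul (by positivity) (by positivity), Real.log_rpow hZ, Real.log_rpow hI,
    Real.log_mul (by positivity) (by positivity), Real.log_exp,
    Real.log_mul hZ.ne' hE.ne'] at l
  have l2 := Real.log_le_sub_one_of_pos hE
  refine le_of_mul_le_mul_left ?_ hs0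
  nlinarith

theorem sq_le_of_forall_mul_le {D e : ℝ} (h : ∀ s : ℝ, s * D ≤ s ^ 2 / 8 + e) : D ^ 2 ≤ e / 2 := by
  -- The maximizer of `sD - s²/8`.
  have := h (4 * D)
  nlinarith

/-- Donsker–Varadhan and Hoeffding: if `ν ∝ e^{-w} μ`, a bound on the entropy of `ν` relative to
`μ` bounds the difference of the measures of a set. -/
theorem sq_measureReal_sub_le {Ω : Type*} [MeasurableSpace Ω] {μ : Measure Ω}
    [IsProbabilityMeasure μ] {w : Ω → ℝ} {e : ℝ} (hw : Integrable (fun x => Real.exp (-w x)) μ)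
    (hwi : Integrable w (μ.tilted fun x => -w x))
    (he : -Real.log (∫ x, Real.exp (-w x) ∂μ) ≤ (∫ x, w x ∂(μ.tilted fun x => -w x)) + e)
    {A : Set Ω} (hA : MeasurableSet A) :
    ((μ.tilted fun x => -w x).real A - μ.real A) ^ 2 ≤ e / 2 := by
  set ν := μ.tilted fun x => -w x
  have hν : IsProbabilityMeasure ν := isProbabilityMeasure_tilted hw
  refine sq_le_of_forall_mul_le fun s => ?_
  set χ : Ω → ℝ := A.indicator fun _ => 1
  have hχm : Measurable χ := measurable_const.indicator hA
  have hχ : ∀ x, χ x ∈ Set.Icc (0 : ℝ) 1 := fun x => by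
    by_cases hx : x ∈ A <;> simp [χ, hx]
  have intχ : ∀ (κ : Measure Ω) [IsFiniteMeasure κ], Integrable χ κ := fun κ _ =>
    (integrable_const (1 : ℝ)).indicator hA
  have valχ : ∀ (κ : Measure Ω), ∫ x, χ x ∂κ = κ.real A := fun κ => by
    simp [χ, integral_indicator hA]
  have hZ : 0 < ∫ x, Real.exp (-w x) ∂μ := integral_exp_pos hw
  have hsχ : Integrable (fun x => Real.exp (s * χ x)) μ := by
    refine Integrable.of_bound (C := Real.exp |s|) (by fun_prop) ?_
    refine Filter.Eventually.of_forall fun x => ?_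
    rw [Real.norm_eq_abs, Real.abs_exp, Real.exp_le_exp]
    refine (le_abs_self _).trans ?_
    rw [abs_mul, abs_of_nonneg (hχ x).1]
    exact mul_le_of_le_one_right (abs_nonneg s) (hχ x).2
  -- Hoeffding's lemma: a variable with values in `[0,1]` is sub-Gaussian with variance proxy `1/4`.
  have hoeff : ∫ x, Real.exp (s * χ x) ∂μ ≤ Real.exp (s * μ.real A + s ^ 2 / 8) := by
    have h := (hasSubgaussianMGF_of_mem_Icc hχm.aemeasurable
      (Filter.Eventually.of_forall hχ : ∀ᵐ x ∂μ, χ x ∈ Set.Icc (0 : ℝ) 1)).mgf_le s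
    rw [mgf, valχ] at h
    have e3 : ∀ x, Real.exp (s * χ x) =
        Real.exp (s * μ.real A) * Real.exp (s * (χ x - μ.real A)) := fun x => by
      rw [← Real.exp_add]; ring_nf
    simp_rw [e3]
    rw [integral_const_mul, Real.exp_add]
    refine mul_le_mul_of_nonneg_left (h.trans ?_) (Real.exp_pos _).le
    rw [Real.exp_le_exp]
    simp
    apply le_of_eq
    ring
  have e4 : ∀ x, Real.exp (-w x) * Real.exp (w x + s * χ x) = Real.exp (s * χ x) := fun x => by
    rw [← Real.exp_add]; ring_nf
  have intexp : Integrable (fun x => Real.exp (w x + s * χ x)) ν := by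
    rw [integrable_tilted_iff hw]
    simpa only [smul_eq_mul, e4] using hsχ
  -- Adding `w` cancels the density of `ν`, so the right side is an integral of `e^{sχ}` against
  -- `μ`, up to normalization.
  have jensen : Real.exp (∫ x, (w x + s * χ x) ∂ν) ≤ ∫ x, Real.exp (w x + s * χ x) ∂ν :=
    convexOn_exp.map_integral_le Real.continuous_exp.continuousOn isClosed_univ
      (Filter.Eventually.of_forall fun _ => Set.mem_univ _)
      (hwi.add ((intχ ν).const_mul s)) intexp
  rw [integral_add hwi ((intχ ν).const_mul s), integral_const_mul, valχ] at jensen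
  have e5 : ∫ x, Real.exp (w x + s * χ x) ∂ν =
      (∫ x, Real.exp (s * χ x) ∂μ) / ∫ x, Real.exp (-w x) ∂μ := by
    rw [integral_exp_tilted]
    congr 2
    ext x
    simp only [Pi.add_apply]
    ring_nf
  rw [e5, le_div_iff₀ hZ] at jensen
  have l := Real.log_le_log (by positivity) (jensen.trans hoeff)
  rw [Real.log_mul (Real.exp_pos _).ne' hZ.ne', Real.log_exp, Real.log_exp] at l
  nlinarith

theorem sq_measureReal_tilted_sub_le (hρ : 0 < ρ) (hη : 0 ≤ η) (hηρ : η * ρ ≤ 1 / 3)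
    (hL : 0 ≤ L)
    (hW : ∀ x ∈ Metric.closedBall 0 ρ, HasFDerivAt W (W' x) x)
    (h1 : ∀ x ∈ Metric.closedBall 0 ρ, ‖W' x‖ ≤ η * ‖x‖ ^ 2 / 2)
    (h2 : ∀ x ∈ Metric.closedBall 0 ρ, ∀ y ∈ Metric.closedBall 0 ρ,
      ‖W' x - W' y‖ ≤ L * ‖x - y‖)
    {A : Set (EuclideanSpace ℝ (Fin d))} (hA : MeasurableSet A) :
    (((volume.restrict (Metric.closedBall 0 ρ)).tilted fun x => -(‖x‖ ^ 2 / 2 + W x)).real A -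
      ((volume.restrict (Metric.closedBall 0 ρ)).tilted fun x => -(‖x‖ ^ 2 / 2)).real A) ^ 2 ≤
    (∫ x, η ^ 2 * ‖x‖ ^ 4 / 3 ∂((volume.restrict
      (Metric.closedBall (0 : EuclideanSpace ℝ (Fin d)) ρ)).tilted fun x => -(‖x‖ ^ 2 / 2))) / 2
    := by
  have main := log_integral_le_integral_tilted hρ hη hηρ hL hW h1 h2
  set B := Metric.closedBall (0 : EuclideanSpace ℝ (Fin d)) ρ
  have hB : IsCompact B := isCompact_closedBall 0 ρ
  have hWc : ContinuousOn W B := fun x hx => (hW x hx).continuousAt.continuousWithinAt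
  have hBpos : 0 < volume B := Metric.measure_closedBall_pos _ _ hρ
  have hne : NeZero (volume.restrict B) := ⟨by
    rw [Ne, Measure.restrict_eq_zero]; exact hBpos.ne'⟩
  have int : ∀ {u : EuclideanSpace ℝ (Fin d) → ℝ}, ContinuousOn u B →
      Integrable (fun x => Real.exp (u x)) (volume.restrict B) := fun hu =>
    (Real.continuous_exp.comp_continuousOn hu).integrableOn_compact hB
  have hVc : ContinuousOn (fun x => -(‖x‖ ^ 2 / 2 + W x)) B := by fun_prop
  have hQc : ContinuousOn (fun x : EuclideanSpace ℝ (Fin d) => -(‖x‖ ^ 2 / 2)) B := by fun_prop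
  set μ := (volume.restrict B).tilted fun x => -(‖x‖ ^ 2 / 2)
  have hμ : IsProbabilityMeasure μ := isProbabilityMeasure_tilted (int hQc)
  have intμ : ∀ {u : EuclideanSpace ℝ (Fin d) → ℝ}, ContinuousOn u B → Integrable u μ := by
    intro u hu
    rw [integrable_tilted_iff (int hQc)]
    exact ((Real.continuous_exp.comp_continuousOn hQc).smul hu).integrableOn_compact hB
  have htt : μ.tilted (fun x => -W x) =
      (volume.restrict B).tilted fun x => -(‖x‖ ^ 2 / 2 + W x) := by
    rw [tilted_tilted (int hQc)]
    congr 1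
    ext x
    simp only [Pi.add_apply]
    ring
  rw [← htt] at main ⊢
  have hZ0 : 0 < ∫ x in B, Real.exp (-(‖x‖ ^ 2 / 2)) := integral_exp_pos (int hQc)
  have hZ1 : 0 < ∫ x in B, Real.exp (-(‖x‖ ^ 2 / 2 + W x)) := integral_exp_pos (int hVc)
  have ex : ∀ u : EuclideanSpace ℝ (Fin d) → ℝ, ∫ x, Real.exp (-u x) ∂μ =
      (∫ x in B, Real.exp (-(‖x‖ ^ 2 / 2 + u x))) / ∫ x in B, Real.exp (-(‖x‖ ^ 2 / 2)) := by
    intro u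
    rw [integral_exp_tilted]
    congr 2
    ext x
    simp only [Pi.add_apply]
    ring_nf
  refine sq_measureReal_sub_le (intμ (by fun_prop)) ?_ ?_ hA
  · rw [htt, integrable_tilted_iff (int hVc)]
    exact ((Real.continuous_exp.comp_continuousOn hVc).smul hWc).integrableOn_compact hB
  · have hGc : ContinuousOn (fun x : EuclideanSpace ℝ (Fin d) => η ^ 2 * ‖x‖ ^ 4 / 3) B := by
      fun_prop
    have hI : 0 < ∫ x in B, Real.exp (-(‖x‖ ^ 2 / 2 + η ^ 2 * ‖x‖ ^ 4 / 3)) :=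
      integral_exp_pos (int (by fun_prop))
    -- Jensen turns the partition function with the quartic term into the mean of that term under
    -- the truncated Gaussian.
    have jensen : Real.exp (∫ x, -(η ^ 2 * ‖x‖ ^ 4 / 3) ∂μ) ≤
        ∫ x, Real.exp (-(η ^ 2 * ‖x‖ ^ 4 / 3)) ∂μ :=
      convexOn_exp.map_integral_le Real.continuous_exp.continuousOn isClosed_univ
        (Filter.Eventually.of_forall fun _ => Set.mem_univ _) (intμ hGc.neg)
        (intμ (Real.continuous_exp.comp_continuousOn hGc.neg))
    rw [ex fun x => η ^ 2 * ‖x‖ ^ 4 / 3, integral_neg] at jensen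
    have l := Real.log_le_log (Real.exp_pos _) jensen
    rw [Real.log_exp, Real.log_div hI.ne' hZ0.ne'] at l
    rw [ex, Real.log_div hZ1.ne' hZ0.ne']
    linarith

end Perturbation

/-! ### Gaussian integrals -/

theorem integral_exp_neg_mul_sq_norm_pos {b : ℝ} (hb : 0 < b) :
    0 < ∫ x : EuclideanSpace ℝ (Fin d), Real.exp (-b * ‖x‖ ^ 2) := by
  rw [GaussianFourier.integral_rexp_neg_mul_sq_norm hb]
  positivity

theorem integrable_exp_neg_mul_sq_norm {b : ℝ} (hb : 0 < b) :
    Integrable fun x : EuclideanSpace ℝ (Fin d) => Real.exp (-b * ‖x‖ ^ 2) := by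
  -- A non-integrable function has integral `0` by convention, which contradicts the positive value.
  by_contra h
  exact (integral_exp_neg_mul_sq_norm_pos (d := d) hb).ne' (integral_undef h)

theorem exp_neg_sq_half (x : EuclideanSpace ℝ (Fin d)) :
    Real.exp (-(‖x‖ ^ 2 / 2)) = Real.exp (-(1 / 2) * ‖x‖ ^ 2) := by
  ring_nf

/-- Polar coordinates reduce both sides to Gamma integrals; the ratio comes from `Γ(t+1) = tΓ(t)`
used twice at `d/2`. -/
theorem integral_norm_pow_four (hd : 0 < d) :
    ∫ x : EuclideanSpace ℝ (Fin d), ‖x‖ ^ 4 * Real.exp (-(1 / 2) * ‖x‖ ^ 2) =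
      (d * (d + 2)) * ∫ x : EuclideanSpace ℝ (Fin d), Real.exp (-(1 / 2) * ‖x‖ ^ 2) := by
  have : NeZero d := ⟨hd.ne'⟩
  have hd' : (0 : ℝ) < d := by exact_mod_cast hd
  have radial : ∀ k : ℕ, ∫ y in Set.Ioi (0 : ℝ), y ^ (d - 1) * (y ^ k * Real.exp (-(1 / 2) * y ^ 2))
      = (1 / 2 : ℝ) ^ (-((d + k : ℝ)) / 2) * (1 / 2) * Real.Gamma ((d + k) / 2) := by
    intro k
    have h := integral_rpow_mul_exp_neg_mul_rpow (p := 2) (q := d + k - 1) (b := 1 / 2)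
      (by norm_num) (by have : (0 : ℝ) ≤ k := Nat.cast_nonneg k; linarith) (by norm_num)
    rw [sub_add_cancel] at h
    rw [← h]
    refine setIntegral_congr_fun measurableSet_Ioi fun y hy => ?_
    have hy' : (0 : ℝ) < y := hy
    rw [← mul_assoc, ← pow_add, ← Real.rpow_natCast y (d - 1 + k), ← Real.rpow_natCast y 2]
    congr 2
    push_cast [Nat.cast_sub (show 1 ≤ d from hd)]
    ring
  have h4 := integral_fun_norm_addHaar (volume : Measure (EuclideanSpace ℝ (Fin d)))
    fun y => y ^ 4 * Real.exp (-(1 / 2) * y ^ 2)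
  have h0 := integral_fun_norm_addHaar (volume : Measure (EuclideanSpace ℝ (Fin d)))
    fun y => y ^ 0 * Real.exp (-(1 / 2) * y ^ 2)
  simp only [finrank_euclideanSpace, Fintype.card_fin, smul_eq_mul, radial, nsmul_eq_mul] at h4 h0
  simp only [pow_zero, one_mul] at h0
  rw [h4, h0]
  have g : Real.Gamma ((d + (4 : ℕ)) / 2) = (d / 2 + 1) * (d / 2) * Real.Gamma (d / 2) := by
    rw [show ((d : ℝ) + (4 : ℕ)) / 2 = d / 2 + 1 + 1 by push_cast; ring,
      Real.Gamma_add_one (by positivity), Real.Gamma_add_one (by positivity)]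
    ring
  have p : (1 / 2 : ℝ) ^ (-((d + (4 : ℕ) : ℝ)) / 2) = 4 * (1 / 2 : ℝ) ^ (-(d : ℝ) / 2) := by
    rw [show -((d + (4 : ℕ) : ℝ)) / 2 = -2 + -(d : ℝ) / 2 by push_cast; ring,
      Real.rpow_add (by norm_num), Real.rpow_neg (by norm_num)]
    norm_num
  rw [g, p]
  simp only [Nat.cast_zero, add_zero]
  ring

theorem integrable_norm_pow_four (hd : 0 < d) :
    Integrable fun x : EuclideanSpace ℝ (Fin d) => ‖x‖ ^ 4 * Real.exp (-(1 / 2) * ‖x‖ ^ 2) := by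
  by_contra h
  have h4 := integral_norm_pow_four hd
  rw [integral_undef h] at h4
  have := integral_exp_neg_mul_sq_norm_pos (d := d) (b := 1 / 2) (by norm_num)
  have hd' : (0 : ℝ) < d := by exact_mod_cast hd
  exact absurd h4 (by positivity)

/-- Truncating to a ball cannot raise the fourth moment above its full value `m`: either `‖x‖⁴ ≤ m`
throughout the ball, or `‖x‖⁴ ≥ m` throughout the complement. -/
theorem integral_norm_pow_four_tilted_le (hd : 0 < d) {ρ : ℝ} (hρ : 0 < ρ) :
    ∫ x, ‖x‖ ^ 4 ∂((volume.restrict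
      (Metric.closedBall (0 : EuclideanSpace ℝ (Fin d)) ρ)).tilted fun x => -(‖x‖ ^ 2 / 2)) ≤
      d * (d + 2) := by
  set B := Metric.closedBall (0 : EuclideanSpace ℝ (Fin d)) ρ
  have hB : MeasurableSet B := measurableSet_closedBall
  set m : ℝ := d * (d + 2)
  have i0 := integrable_exp_neg_mul_sq_norm (d := d) (b := 1 / 2) (by norm_num)
  have i4 := integrable_norm_pow_four hd
  have hBpos : 0 < volume B := Metric.measure_closedBall_pos _ _ hρ
  have hne : NeZero (volume.restrict B) := ⟨by
    rw [Ne, Measure.restrict_eq_zero]; exact hBpos.ne'⟩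
  have hZ : 0 < ∫ x in B, Real.exp (-(1 / 2) * ‖x‖ ^ 2) := integral_exp_pos i0.integrableOn
  simp_rw [integral_tilted, exp_neg_sq_half, smul_eq_mul, div_mul_eq_mul_div, integral_div,
    mul_comm _ (‖_‖ ^ 4)]
  rw [div_le_iff₀ hZ, ← integral_const_mul]
  rcases le_total (ρ ^ 4) m with h | h
  · refine setIntegral_mono_on i4.integrableOn (i0.const_mul m).integrableOn hB fun x hx => ?_
    have hx' : ‖x‖ ≤ ρ := by simpa [B] using hx
    refine mul_le_mul_of_nonneg_right ?_ (Real.exp_pos _).le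
    exact (pow_le_pow_left₀ (norm_nonneg _) hx' 4).trans h
  · have hc : ∫ x in Bᶜ, m * Real.exp (-(1 / 2) * ‖x‖ ^ 2) ≤
        ∫ x in Bᶜ, ‖x‖ ^ 4 * Real.exp (-(1 / 2) * ‖x‖ ^ 2) := by
      refine setIntegral_mono_on (i0.const_mul m).integrableOn i4.integrableOn hB.compl
        fun x hx => ?_
      have hx' : ρ < ‖x‖ := by simpa [B] using hx
      refine mul_le_mul_of_nonneg_right ?_ (Real.exp_pos _).le
      exact h.trans (pow_le_pow_left₀ hρ.le hx'.le 4)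
    have e4 := integral_add_compl hB i4
    have e0 := integral_add_compl hB (i0.const_mul m)
    rw [integral_norm_pow_four hd] at e4
    have et : ∫ x : EuclideanSpace ℝ (Fin d), m * Real.exp (-(1 / 2) * ‖x‖ ^ 2) =
        m * ∫ x : EuclideanSpace ℝ (Fin d), Real.exp (-(1 / 2) * ‖x‖ ^ 2) :=
      integral_const_mul _ _
    linarith

/-- Chernoff bound: the part `a - b` of the exponent is evaluated at the radius, the part `b` is
integrated over the whole space. -/
theorem setIntegral_compl_closedBall_le {a b ρ : ℝ} (hb : 0 < b) (hab : b ≤ a) (hρ : 0 ≤ ρ) :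
    ∫ x in (Metric.closedBall (0 : EuclideanSpace ℝ (Fin d)) ρ)ᶜ, Real.exp (-a * ‖x‖ ^ 2) ≤
      Real.exp (-(a - b) * ρ ^ 2) * (Real.pi / b) ^ ((d : ℝ) / 2) := by
  have h0 := GaussianFourier.integral_rexp_neg_mul_sq_norm (V := EuclideanSpace ℝ (Fin d)) hb
  rw [finrank_euclideanSpace, Fintype.card_fin] at h0
  rw [← h0, ← integral_const_mul]
  have ia := integrable_exp_neg_mul_sq_norm (d := d) (hb.trans_le hab)
  have ib := (integrable_exp_neg_mul_sq_norm (d := d) hb).const_mul (Real.exp (-(a - b) * ρ ^ 2))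
  refine (setIntegral_mono_on ia.integrableOn ib.integrableOn measurableSet_closedBall.compl
    fun x hx => ?_).trans (setIntegral_le_integral ib (Filter.Eventually.of_forall fun x => ?_))
  · have hx' : ρ < ‖x‖ := by simpa using hx
    rw [← Real.exp_add, Real.exp_le_exp]
    have : ρ ^ 2 ≤ ‖x‖ ^ 2 := pow_le_pow_left₀ hρ hx'.le 2
    nlinarith
  · positivity

/-- The standard Gaussian measure has density proportional to `e^{-|x|²/2}`. -/
theorem stdGaussian_eq_tilted :
    stdGaussian (EuclideanSpace ℝ (Fin d)) =
      (volume : Measure (EuclideanSpace ℝ (Fin d))).tilted fun x => -(‖x‖ ^ 2 / 2) := by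
  have hi : Integrable fun x : EuclideanSpace ℝ (Fin d) => Real.exp (-(‖x‖ ^ 2 / 2)) := by
    simpa only [exp_neg_sq_half] using integrable_exp_neg_mul_sq_norm (d := d) (by norm_num)
  have hp := isProbabilityMeasure_tilted hi
  refine Measure.ext_of_charFun ?_
  ext t
  -- The two measures are identified by their characteristic functions.
  rw [charFun_stdGaussian, charFun_apply, integral_tilted]
  have h0 := GaussianFourier.integral_rexp_neg_mul_sq_norm (V := EuclideanSpace ℝ (Fin d))
    (b := 1 / 2) (by norm_num)
  have h1 := GaussianFourier.integral_cexp_neg_mul_sq_norm_add (V := EuclideanSpace ℝ (Fin d))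
    (b := 1 / 2) (by norm_num) Complex.I t
  simp_rw [exp_neg_sq_half]
  rw [h0]
  have e : ∀ x : EuclideanSpace ℝ (Fin d),
      (Real.exp (-(1 / 2) * ‖x‖ ^ 2) / (Real.pi / (1 / 2)) ^
        ((Module.finrank ℝ (EuclideanSpace ℝ (Fin d)) : ℝ) / 2)) •
        Complex.exp (inner ℝ x t * Complex.I) =
      ((((Real.pi / (1 / 2)) ^
        ((Module.finrank ℝ (EuclideanSpace ℝ (Fin d)) : ℝ) / 2) : ℝ) : ℂ))⁻¹ *
        Complex.exp (-(1 / 2) * ‖x‖ ^ 2 + Complex.I * inner ℝ t x) := by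
    intro x
    rw [Complex.real_smul, Complex.exp_add, real_inner_comm t x]
    push_cast
    ring_nf
  simp_rw [e]
  rw [integral_const_mul, h1, Complex.ofReal_cpow (by positivity)]
  push_cast
  rw [inv_mul_cancel_left₀]
  · congr 1
    rw [Complex.I_sq]
    ring
  · rw [Ne, Complex.cpow_eq_zero_iff, not_and_or]
    left
    simp [Real.pi_ne_zero]

/-! ### Exponential integrals -/

theorem integral_exp_neg_mul_abs {c : ℝ} (hc : 0 < c) :
    ∫ t : ℝ, Real.exp (-c * |t|) = 2 / c := by
  rw [integral_comp_abs (f := fun t => Real.exp (-c * t)), integral_exp_mul_Ioi (by linarith)]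
  simp
  ring

theorem integrable_exp_neg_mul_abs {c : ℝ} (hc : 0 < c) :
    Integrable fun t : ℝ => Real.exp (-c * |t|) := by
  by_contra h
  have h2 := integral_exp_neg_mul_abs hc
  rw [integral_undef h] at h2
  exact absurd h2 (by positivity)

theorem exp_neg_mul_sum_abs (c : ℝ) (x : Fin d → ℝ) :
    Real.exp (-c * ∑ i, |x i|) = ∏ i, Real.exp (-c * |x i|) := by
  rw [Finset.mul_sum, Real.exp_sum]

theorem integrable_exp_neg_mul_sum_abs {c : ℝ} (hc : 0 < c) :
    Integrable fun x : EuclideanSpace ℝ (Fin d) => Real.exp (-c * ∑ i, |x i|) := by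
  have h : Integrable fun x : Fin d → ℝ => ∏ i, Real.exp (-c * |x i|) :=
    Integrable.fintype_prod fun _ => integrable_exp_neg_mul_abs hc
  simp_rw [← exp_neg_mul_sum_abs] at h
  exact (PiLp.volume_preserving_ofLp (Fin d)).integrable_comp_of_integrable h

theorem integral_exp_neg_mul_sum_abs {c : ℝ} (hc : 0 < c) :
    ∫ x : EuclideanSpace ℝ (Fin d), Real.exp (-c * ∑ i, |x i|) = (2 / c) ^ d := by
  have h := (PiLp.volume_preserving_ofLp (Fin d)).integral_comp
    (MeasurableEquiv.toLp 2 (Fin d → ℝ)).symm.measurableEmbedding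
    (fun x : Fin d → ℝ => Real.exp (-c * ∑ i, |x i|))
  rw [h]
  simp_rw [exp_neg_mul_sum_abs]
  rw [integral_fintype_prod_volume_eq_pow fun t => Real.exp (-c * |t|), integral_exp_neg_mul_abs hc]
  simp

theorem sum_abs_le_sqrt_mul_norm (x : EuclideanSpace ℝ (Fin d)) :
    ∑ i, |x i| ≤ √d * ‖x‖ := by
  rw [EuclideanSpace.norm_eq, ← Real.sqrt_mul (Nat.cast_nonneg d)]
  refine Real.le_sqrt_of_sq_le ?_
  simpa using sq_sum_le_card_mul_sum_sq (s := Finset.univ) (f := fun i => |x i|)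

/-! ### Localization to a ball -/

theorem measureReal_tilted {Ω : Type*} [MeasurableSpace Ω] {μ : Measure Ω} (u : Ω → ℝ) {A : Set Ω}
    (hA : MeasurableSet A) :
    (μ.tilted u).real A = (∫ x in A, Real.exp (u x) ∂μ) / ∫ x, Real.exp (u x) ∂μ := by
  rw [measureReal_def, tilted_apply_eq_ofReal_integral' _ hA, integral_div,
    ENNReal.toReal_ofReal]
  exact div_nonneg (integral_nonneg fun _ => (Real.exp_pos _).le)
    (integral_nonneg fun _ => (Real.exp_pos _).le)

/-- Conditioning on `S` moves the probability of any event by at most the mass of `Sᶜ`: by `e3` the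
difference is `(q - (p/a) c)/Z`, where both terms of the numerator lie in `[0, c]`. -/
theorem abs_measureReal_tilted_sub_restrict_le {Ω : Type*} [MeasurableSpace Ω] {μ : Measure Ω}
    {u : Ω → ℝ} (hu : Integrable (fun x => Real.exp (u x)) μ) {S : Set Ω} (hS : MeasurableSet S)
    (hS0 : 0 < ∫ x in S, Real.exp (u x) ∂μ) {A : Set Ω} (hA : MeasurableSet A) :
    |(μ.tilted u).real A - ((μ.restrict S).tilted u).real A| ≤
      (∫ x in Sᶜ, Real.exp (u x) ∂μ) / ∫ x, Real.exp (u x) ∂μ := by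
  have nn : ∀ T : Set Ω, 0 ≤ ∫ x in T, Real.exp (u x) ∂μ := fun T =>
    integral_nonneg fun _ => (Real.exp_pos _).le
  have hZ : 0 < ∫ x, Real.exp (u x) ∂μ := by
    rw [← integral_add_compl hS hu]
    linarith [nn Sᶜ]
  rw [measureReal_tilted u hA, measureReal_tilted u hA, Measure.restrict_restrict hA]
  have e1 : ∫ x in A, Real.exp (u x) ∂μ =
      (∫ x in A ∩ S, Real.exp (u x) ∂μ) + ∫ x in A \ S, Real.exp (u x) ∂μ :=
    (integral_inter_add_sdiff hS hu.integrableOn).symm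
  have e2 : ∫ x, Real.exp (u x) ∂μ = (∫ x in S, Real.exp (u x) ∂μ) +
      ∫ x in Sᶜ, Real.exp (u x) ∂μ := (integral_add_compl hS hu).symm
  have i1 : ∫ x in A ∩ S, Real.exp (u x) ∂μ ≤ ∫ x in S, Real.exp (u x) ∂μ :=
    setIntegral_mono_set hu.integrableOn
      (Filter.Eventually.of_forall fun _ => (Real.exp_pos _).le)
      Set.inter_subset_right.eventuallyLE
  have i2 : ∫ x in A \ S, Real.exp (u x) ∂μ ≤ ∫ x in Sᶜ, Real.exp (u x) ∂μ :=
    setIntegral_mono_set hu.integrableOn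
      (Filter.Eventually.of_forall fun _ => (Real.exp_pos _).le)
      (show A \ S ⊆ Sᶜ from fun x hx => hx.2).eventuallyLE
  have n1 := nn (A ∩ S)
  have n2 := nn (A \ S)
  have n3 := nn Sᶜ
  rw [e1]
  set p := ∫ x in A ∩ S, Real.exp (u x) ∂μ
  set q := ∫ x in A \ S, Real.exp (u x) ∂μ
  set a := ∫ x in S, Real.exp (u x) ∂μ
  set c := ∫ x in Sᶜ, Real.exp (u x) ∂μ
  set Z := ∫ x, Real.exp (u x) ∂μ
  have e3 : (p + q) / Z - p / a = (q - p / a * c) / Z := by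
    rw [e2]
    have : a + c ≠ 0 := by linarith
    field_simp
    ring
  have hpa : p / a ≤ 1 := (div_le_one hS0).2 i1
  have hpa0 : 0 ≤ p / a := by positivity
  rw [e3, abs_div, abs_of_pos hZ]
  refine div_le_div_of_nonneg_right (abs_le.2 ⟨?_, ?_⟩) hZ.le <;> nlinarith

theorem abs_tilted_sub_tilted_le (hd : 0 < d)
    {W : EuclideanSpace ℝ (Fin d) → ℝ}
    {W' : EuclideanSpace ℝ (Fin d) → EuclideanSpace ℝ (Fin d) →L[ℝ] ℝ} {η ρ L : ℝ}
    (hρ : 0 < ρ) (hη : 0 ≤ η) (hηρ : η * ρ ≤ 1 / 3) (hL : 0 ≤ L)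
    (hW : ∀ x ∈ Metric.closedBall 0 ρ, HasFDerivAt W (W' x) x)
    (h1 : ∀ x ∈ Metric.closedBall 0 ρ, ‖W' x‖ ≤ η * ‖x‖ ^ 2 / 2)
    (h2 : ∀ x ∈ Metric.closedBall 0 ρ, ∀ y ∈ Metric.closedBall 0 ρ,
      ‖W' x - W' y‖ ≤ L * ‖x - y‖)
    {A : Set (EuclideanSpace ℝ (Fin d))} (hA : MeasurableSet A) :
    |((volume.restrict (Metric.closedBall 0 ρ)).tilted fun x => -(‖x‖ ^ 2 / 2 + W x)).real A -
      ((volume.restrict (Metric.closedBall 0 ρ)).tilted fun x => -(‖x‖ ^ 2 / 2)).real A| ≤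
    η * d / √2 := by
  have hd' : (1 : ℝ) ≤ d := by exact_mod_cast hd
  refine abs_le_of_sq_le_sq ?_ (by positivity)
  refine (sq_measureReal_tilted_sub_le hρ hη hηρ hL hW h1 h2 hA).trans ?_
  have e : ∀ x : EuclideanSpace ℝ (Fin d), η ^ 2 * ‖x‖ ^ 4 / 3 = η ^ 2 / 3 * ‖x‖ ^ 4 :=
    fun x => by ring
  simp_rw [e]
  rw [integral_const_mul, div_pow, Real.sq_sqrt (by norm_num)]
  have h := mul_le_mul_of_nonneg_left (integral_norm_pow_four_tilted_le hd hρ)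
    (by positivity : 0 ≤ η ^ 2 / 3)
  -- Here `d ≥ 1` enters, through `d + 2 ≤ 3d`.
  have h3 : η ^ 2 / 3 * (d * (d + 2)) ≤ (η * d) ^ 2 := by
    have : η ^ 2 * (d * (d + 2)) ≤ η ^ 2 * (3 * d ^ 2) :=
      mul_le_mul_of_nonneg_left (by nlinarith) (by positivity)
    nlinarith
  linarith

/-- A lower bound on a sphere for a convex function vanishing at the centre extends linearly
outwards. -/
theorem norm_mul_le_of_convexOn {D : Set (EuclideanSpace ℝ (Fin d))}
    {V : EuclideanSpace ℝ (Fin d) → ℝ} (hV : ConvexOn ℝ D V) (h0 : (0 : EuclideanSpace ℝ (Fin d)) ∈ D)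
    (hV0 : V 0 = 0) {ρ a : ℝ} (hρ : 0 < ρ) (hs : ∀ x ∈ D, ‖x‖ = ρ → a * ρ ≤ V x)
    {x : EuclideanSpace ℝ (Fin d)} (hx : x ∈ D) (hρx : ρ ≤ ‖x‖) : a * ‖x‖ ≤ V x := by
  have hx0 : 0 < ‖x‖ := hρ.trans_le hρx
  have ht1 : ρ / ‖x‖ ≤ 1 := (div_le_one hx0).2 hρx
  have ht0 : 0 ≤ ρ / ‖x‖ := by positivity
  have hmem : (ρ / ‖x‖) • x ∈ D := by
    have := hV.1 h0 hx (by linarith : 0 ≤ 1 - ρ / ‖x‖) ht0 (by ring)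
    simpa using this
  have hc := hV.2 h0 hx (by linarith : 0 ≤ 1 - ρ / ‖x‖) ht0 (by ring)
  simp only [smul_zero, zero_add, hV0, smul_eq_mul, mul_zero] at hc
  have hb := hs _ hmem (by
    rw [norm_smul, Real.norm_eq_abs, abs_of_nonneg ht0, div_mul_cancel₀ _ hx0.ne'])
  have := hb.trans hc
  rw [div_mul_eq_mul_div, le_div_iff₀ hx0] at this
  nlinarith

/-! ### Mass of a convex potential outside and inside the ball. -/

section Tails

variable {D : Set (EuclideanSpace ℝ (Fin d))} {V : EuclideanSpace ℝ (Fin d) → ℝ} {ρ : ℝ}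

/-- The slope `4/9` splits as `1/3 + 1/9`: the first part gives `ρ²/3`, and the second dominates
`(4/9)√d‖x‖`, hence `4/9` of the `ℓ¹` norm, whose exponential integrates explicitly. -/
theorem exp_neg_le_of_linear_growth (hρd : 4 * √d ≤ ρ)
    {x : EuclideanSpace ℝ (Fin d)} (hx : 4 / 9 * ρ * ‖x‖ ≤ V x) (hρx : ρ ≤ ‖x‖) :
    Real.exp (-V x) ≤ Real.exp (-(ρ ^ 2 / 3)) * Real.exp (-(4 / 9) * ∑ i, |x i|) := by
  rw [← Real.exp_add, Real.exp_le_exp]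
  have h1 := sum_abs_le_sqrt_mul_norm x
  have h2 : 4 * √d * ‖x‖ ≤ ρ * ‖x‖ := mul_le_mul_of_nonneg_right hρd (norm_nonneg _)
  have hρ0 : 0 ≤ ρ := le_trans (by positivity) hρd
  nlinarith

theorem integrableOn_exp_neg_of_growth (hρd : 4 * √d ≤ ρ) (hD : MeasurableSet D)
    (hVc : ContinuousOn V D) (hBD : Metric.closedBall 0 ρ ⊆ D)
    (hg : ∀ x ∈ D, ρ ≤ ‖x‖ → 4 / 9 * ρ * ‖x‖ ≤ V x) :
    IntegrableOn (fun x => Real.exp (-V x)) D := by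
  have hcont : ContinuousOn (fun x => Real.exp (-V x)) D :=
    Real.continuous_exp.comp_continuousOn hVc.neg
  have h1 : IntegrableOn (fun x => Real.exp (-V x)) (Metric.closedBall 0 ρ) :=
    (hcont.mono hBD).integrableOn_compact (isCompact_closedBall 0 ρ)
  have h2 : IntegrableOn (fun x => Real.exp (-V x)) (D \ Metric.closedBall 0 ρ) := by
    refine Integrable.mono' (g := fun x => Real.exp (-(ρ ^ 2 / 3)) *
      Real.exp (-(4 / 9) * ∑ i, |x i|))
      ((integrable_exp_neg_mul_sum_abs (by norm_num)).const_mul _).integrableOn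
      ((hcont.mono Set.sdiff_subset).aestronglyMeasurable (hD.diff measurableSet_closedBall)) ?_
    refine (ae_restrict_iff' (hD.diff measurableSet_closedBall)).2
      (Filter.Eventually.of_forall fun x hx => ?_)
    have hx' : ρ < ‖x‖ := by simpa using hx.2
    rw [Real.norm_eq_abs, abs_of_pos (Real.exp_pos _)]
    exact exp_neg_le_of_linear_growth hρd (hg x hx.1 hx'.le) hx'.le
  have := h1.union h2
  rwa [Set.union_sdiff_cancel hBD] at this

theorem setIntegral_diff_closedBall_le (hρd : 4 * √d ≤ ρ) (hD : MeasurableSet D)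
    (hVi : IntegrableOn (fun x => Real.exp (-V x)) D)
    (hg : ∀ x ∈ D, ρ ≤ ‖x‖ → 4 / 9 * ρ * ‖x‖ ≤ V x) :
    ∫ x in D \ Metric.closedBall 0 ρ, Real.exp (-V x) ≤
      Real.exp (-(ρ ^ 2 / 3)) * (9 / 2) ^ d := by
  have hm := hD.diff (measurableSet_closedBall (x := (0 : EuclideanSpace ℝ (Fin d))) (ε := ρ))
  have hi := (integrable_exp_neg_mul_sum_abs (d := d) (c := 4 / 9) (by norm_num)).const_mul
    (Real.exp (-(ρ ^ 2 / 3)))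
  calc ∫ x in D \ Metric.closedBall 0 ρ, Real.exp (-V x)
      ≤ ∫ x in D \ Metric.closedBall 0 ρ, Real.exp (-(ρ ^ 2 / 3)) *
          Real.exp (-(4 / 9) * ∑ i, |x i|) := by
        refine setIntegral_mono_on (hVi.mono_set Set.sdiff_subset) hi.integrableOn hm fun x hx => ?_
        have hx' : ρ < ‖x‖ := by simpa using hx.2
        exact exp_neg_le_of_linear_growth hρd (hg x hx.1 hx'.le) hx'.le
    _ ≤ ∫ x : EuclideanSpace ℝ (Fin d), Real.exp (-(ρ ^ 2 / 3)) * Real.exp (-(4 / 9) * ∑ i, |x i|) :=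
        setIntegral_le_integral hi (Filter.Eventually.of_forall fun x => by positivity)
    _ = _ := by
        rw [integral_const_mul, integral_exp_neg_mul_sum_abs (by norm_num)]
        norm_num

theorem two_pow_le_setIntegral_closedBall (hd : 0 < d) (hρd : 4 * √d ≤ ρ)
    (hVc : ContinuousOn V (Metric.closedBall 0 ρ))
    (hu : ∀ x ∈ Metric.closedBall 0 ρ, V x ≤ 5 / 9 * ‖x‖ ^ 2) :
    2 ^ d / 2 ≤ ∫ x in Metric.closedBall 0 ρ, Real.exp (-V x) := by
  have hd' : (1 : ℝ) ≤ d := by exact_mod_cast hd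
  have hρ0 : 0 ≤ ρ := le_trans (by positivity) hρd
  have hρ2 : 16 * (d : ℝ) ≤ ρ ^ 2 := by
    have := pow_le_pow_left₀ (by positivity) hρd 2
    rwa [mul_pow, Real.sq_sqrt (Nat.cast_nonneg d), show (4 : ℝ) ^ 2 = 16 by norm_num] at this
  have i0 := integrable_exp_neg_mul_sq_norm (d := d) (b := 5 / 9) (by norm_num)
  have hB : MeasurableSet (Metric.closedBall (0 : EuclideanSpace ℝ (Fin d)) ρ) :=
    measurableSet_closedBall
  have hlow : ∫ x in Metric.closedBall (0 : EuclideanSpace ℝ (Fin d)) ρ,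
      Real.exp (-(5 / 9) * ‖x‖ ^ 2) ≤
      ∫ x in Metric.closedBall (0 : EuclideanSpace ℝ (Fin d)) ρ, Real.exp (-V x) := by
    refine setIntegral_mono_on i0.integrableOn
      ((Real.continuous_exp.comp_continuousOn hVc.neg).integrableOn_compact
        (isCompact_closedBall 0 ρ)) hB fun x hx => ?_
    rw [Real.exp_le_exp]
    linarith [hu x hx]
  have htail := setIntegral_compl_closedBall_le (d := d) (a := 5 / 9) (b := 5 / 18) (ρ := ρ)
    (by norm_num) (by norm_num) hρ0
  have hsum := integral_add_compl hB i0
  rw [GaussianFourier.integral_rexp_neg_mul_sq_norm (by norm_num), finrank_euclideanSpace,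
    Fintype.card_fin] at hsum
  set G : ℝ := (Real.pi / (5 / 9)) ^ ((d : ℝ) / 2)
  -- The full Gaussian integral is `(9π/5)^{d/2}`, and `9π/5 ≥ 4`. The rest of the proof shows that
  -- its tail is at most half of it.
  have hG : (2 : ℝ) ^ d ≤ G := by
    have h4 : (2 : ℝ) ^ d = (4 : ℝ) ^ ((d : ℝ) / 2) := by
      rw [show (4 : ℝ) = 2 ^ (2 : ℝ) by norm_num, ← Real.rpow_mul (by norm_num),
        mul_div_cancel₀ _ (by norm_num), Real.rpow_natCast]
    rw [h4]
    exact Real.rpow_le_rpow (by norm_num) (by linarith [Real.pi_gt_three]) (by positivity)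
  have hG2 : (Real.pi / (5 / 18)) ^ ((d : ℝ) / 2) ≤ 2 ^ d * G := by
    rw [show Real.pi / (5 / 18) = 2 * (Real.pi / (5 / 9)) by ring,
      Real.mul_rpow (by norm_num) (by positivity)]
    refine mul_le_mul_of_nonneg_right ?_ (by positivity)
    rw [← Real.rpow_natCast]
    exact Real.rpow_le_rpow_of_exponent_le (by norm_num) (by linarith)
  have hexp : Real.exp (-(5 / 9 - 5 / 18) * ρ ^ 2) * 2 ^ d ≤ 1 / 2 := by
    have e1 : Real.exp (-(5 / 9 - 5 / 18) * ρ ^ 2) ≤ Real.exp (-4) ^ d := by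
      rw [← Real.exp_nat_mul, Real.exp_le_exp]
      nlinarith
    have e2 : Real.exp (-4) ≤ 1 / 4 := by
      rw [Real.exp_neg, inv_eq_one_div]
      refine one_div_le_one_div_of_le (by norm_num) ?_
      linarith [Real.add_one_le_exp (4 : ℝ)]
    calc _ ≤ Real.exp (-4) ^ d * 2 ^ d := mul_le_mul_of_nonneg_right e1 (by positivity)
      _ = (Real.exp (-4) * 2) ^ d := (mul_pow _ _ _).symm
      _ ≤ (1 / 2) ^ d := pow_le_pow_left₀ (by positivity) (by linarith) d
      _ ≤ (1 / 2) ^ 1 := pow_le_pow_of_le_one (by norm_num) (by norm_num) hd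
      _ = 1 / 2 := by norm_num
  have hG0 : 0 ≤ G := by positivity
  have : Real.exp (-(5 / 9 - 5 / 18) * ρ ^ 2) * (Real.pi / (5 / 18)) ^ ((d : ℝ) / 2) ≤
      1 / 2 * G := by
    calc _ ≤ Real.exp (-(5 / 9 - 5 / 18) * ρ ^ 2) * (2 ^ d * G) :=
          mul_le_mul_of_nonneg_left hG2 (Real.exp_pos _).le
      _ = Real.exp (-(5 / 9 - 5 / 18) * ρ ^ 2) * 2 ^ d * G := by ring
      _ ≤ _ := mul_le_mul_of_nonneg_right hexp hG0
  linarith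

end Tails

theorem gaussian_tail_le {r : ℝ} (hr : 6 ≤ r) :
    (∫ x in (Metric.closedBall (0 : EuclideanSpace ℝ (Fin d)) (2 / 3 * (r * √d)))ᶜ,
      Real.exp (-(‖x‖ ^ 2 / 2))) / ∫ x : EuclideanSpace ℝ (Fin d), Real.exp (-(‖x‖ ^ 2 / 2)) ≤
    Real.exp (-(d * r ^ 2 / 9)) := by
  have hρ0 : 0 ≤ 2 / 3 * (r * √d) := by positivity
  simp_rw [exp_neg_sq_half]
  rw [div_le_iff₀ (integral_exp_neg_mul_sq_norm_pos (by norm_num))]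
  refine (setIntegral_compl_closedBall_le (b := 1 / 8) (by norm_num) (by norm_num) hρ0).trans ?_
  rw [GaussianFourier.integral_rexp_neg_mul_sq_norm (by norm_num), finrank_euclideanSpace,
    Fintype.card_fin, show Real.pi / (1 / 8) = 2 ^ (2 : ℝ) * (Real.pi / (1 / 2)) by norm_num; ring,
    Real.mul_rpow (by positivity) (by positivity), ← Real.rpow_mul (by norm_num),
    mul_div_cancel₀ _ (by norm_num), Real.rpow_natCast, ← mul_assoc]
  refine mul_le_mul_of_nonneg_right ?_ (by positivity)
  have h2 : (2 : ℝ) ^ d ≤ Real.exp 1 ^ d :=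
    pow_le_pow_left₀ (by norm_num) (by linarith [Real.add_one_le_exp (1 : ℝ)]) d
  calc _ ≤ Real.exp (-(1 / 2 - 1 / 8) * (2 / 3 * (r * √d)) ^ 2) * Real.exp 1 ^ d :=
        mul_le_mul_of_nonneg_left h2 (Real.exp_pos _).le
    _ ≤ _ := by
        rw [← Real.exp_nat_mul, ← Real.exp_add, Real.exp_le_exp, mul_pow, mul_pow,
          Real.sq_sqrt (Nat.cast_nonneg d)]
        have : (0 : ℝ) ≤ d := Nat.cast_nonneg d
        nlinarith [mul_le_mul_of_nonneg_left (by nlinarith : (36 : ℝ) ≤ r ^ 2) this]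

/-- The exponent `4dr²/27` exceeds `dr²/9` by `dr²/27 ≥ 4d/3`, which pays for `(9/2)^d` since `9/2 ≤
2e^{4/3}`. The factor `2^d/2` is the lower bound for the mass of the ball. -/
theorem log_concave_tail_le {r : ℝ} (hr : 6 ≤ r) :
    Real.exp (-((2 / 3 * (r * √d)) ^ 2 / 3)) * (9 / 2) ^ d ≤
      2 * Real.exp (-(d * r ^ 2 / 9)) * (2 ^ d / 2) := by
  have h1 : (9 / 2 : ℝ) ^ d ≤ Real.exp (4 / 3) ^ d * 2 ^ d := by
    rw [← mul_pow]
    exact pow_le_pow_left₀ (by norm_num) (by linarith [Real.add_one_le_exp (4 / 3 : ℝ)]) d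
  calc _ ≤ Real.exp (-((2 / 3 * (r * √d)) ^ 2 / 3)) * (Real.exp (4 / 3) ^ d * 2 ^ d) :=
        mul_le_mul_of_nonneg_left h1 (Real.exp_pos _).le
    _ = Real.exp (-((2 / 3 * (r * √d)) ^ 2 / 3) + d * (4 / 3)) * 2 ^ d := by
        rw [← Real.exp_nat_mul, Real.exp_add, mul_assoc]
    _ ≤ Real.exp (-(d * r ^ 2 / 9)) * 2 ^ d := by
        refine mul_le_mul_of_nonneg_right ?_ (by positivity)
        rw [Real.exp_le_exp, mul_pow, mul_pow, Real.sq_sqrt (Nat.cast_nonneg d)]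
        have : (0 : ℝ) ≤ d := Nat.cast_nonneg d
        nlinarith [mul_le_mul_of_nonneg_left (by nlinarith : (36 : ℝ) ≤ r ^ 2) this]
    _ = _ := by ring

/-- The total variation bound in standardized coordinates. -/
theorem standardized_bound (hd : 0 < d) {r η L : ℝ} (hr : 6 ≤ r) (hη : 0 ≤ η)
    (hηr : η * (r * √d) ≤ 1 / 2) (hL : 0 ≤ L) {D : Set (EuclideanSpace ℝ (Fin d))}
    (hD : MeasurableSet D) (hBD : Metric.closedBall 0 (2 / 3 * (r * √d)) ⊆ D)
    {W : EuclideanSpace ℝ (Fin d) → ℝ}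
    {W' : EuclideanSpace ℝ (Fin d) → EuclideanSpace ℝ (Fin d) →L[ℝ] ℝ}
    (hV : ConvexOn ℝ D fun x => ‖x‖ ^ 2 / 2 + W x) (hWc : ContinuousOn W D)
    (hW : ∀ x ∈ Metric.closedBall 0 (2 / 3 * (r * √d)), HasFDerivAt W (W' x) x)
    (h0 : ∀ x ∈ Metric.closedBall 0 (2 / 3 * (r * √d)), |W x| ≤ η * ‖x‖ ^ 3 / 6)
    (h1 : ∀ x ∈ Metric.closedBall 0 (2 / 3 * (r * √d)), ‖W' x‖ ≤ η * ‖x‖ ^ 2 / 2)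
    (h2 : ∀ x ∈ Metric.closedBall 0 (2 / 3 * (r * √d)),
      ∀ y ∈ Metric.closedBall 0 (2 / 3 * (r * √d)), ‖W' x - W' y‖ ≤ L * ‖x - y‖) :
    IntegrableOn (fun x => Real.exp (-(‖x‖ ^ 2 / 2 + W x))) D ∧
    ∀ A, MeasurableSet A →
      |((volume.restrict D).tilted fun x => -(‖x‖ ^ 2 / 2 + W x)).real A -
        (stdGaussian (EuclideanSpace ℝ (Fin d))).real A| ≤
      η * d / √2 + 3 * Real.exp (-(d * r ^ 2 / 9)) := by
  have hd' : (1 : ℝ) ≤ d := by exact_mod_cast hd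
  have hsd : 0 < √(d : ℝ) := Real.sqrt_pos.2 (by linarith)
  have hgt := gaussian_tail_le (d := d) hr
  have hlt := log_concave_tail_le (d := d) hr
  -- The factor `2/3` serves twice: it turns `r ≥ 6` into `ρ ≥ 4√d`, and the bound `1/2` for `η r√d`
  -- into `ηρ ≤ 1/3`.
  have hρd : 4 * √d ≤ 2 / 3 * (r * √d) := by nlinarith
  have hηρ : η * (2 / 3 * (r * √d)) ≤ 1 / 3 := by linarith
  set ρ := 2 / 3 * (r * √d)
  have hρ : 0 < ρ := lt_of_lt_of_le (by positivity) hρd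
  have hB : MeasurableSet (Metric.closedBall (0 : EuclideanSpace ℝ (Fin d)) ρ) :=
    measurableSet_closedBall
  set V : EuclideanSpace ℝ (Fin d) → ℝ := fun x => ‖x‖ ^ 2 / 2 + W x
  have hVc : ContinuousOn V D := by fun_prop
  have h0B : (0 : EuclideanSpace ℝ (Fin d)) ∈ Metric.closedBall 0 ρ := by simp [hρ.le]
  have hV0 : V 0 = 0 := by
    have := h0 0 h0B
    simp only [norm_zero] at this
    have hW0 : W 0 = 0 := abs_nonpos_iff.1 (by linarith)
    simp [V, hW0]
  -- Hence `V` lies between `(4/9)‖x‖²` and `(5/9)‖x‖²` on the ball, as `1/2 ∓ 1/18` are `4/9` and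
  -- `5/9`.
  have hcube : ∀ x ∈ Metric.closedBall (0 : EuclideanSpace ℝ (Fin d)) ρ,
      |W x| ≤ ‖x‖ ^ 2 / 18 := by
    intro x hx
    refine (h0 x hx).trans ?_
    have hx' : ‖x‖ ≤ ρ := by simpa using hx
    have : η * ‖x‖ ≤ 1 / 3 := (mul_le_mul_of_nonneg_left hx' hη).trans hηρ
    have := mul_le_mul_of_nonneg_right this (sq_nonneg ‖x‖)
    nlinarith
  have hg : ∀ x ∈ D, ρ ≤ ‖x‖ → 4 / 9 * ρ * ‖x‖ ≤ V x := by
    intro x hx hρx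
    refine norm_mul_le_of_convexOn hV (hBD h0B) hV0 hρ (fun y _ hyρ => ?_) hx hρx
    have := (abs_le.1 (hcube y (by simp [hyρ]))).1
    simp only [V]
    rw [hyρ] at this ⊢
    nlinarith
  have hu : ∀ x ∈ Metric.closedBall (0 : EuclideanSpace ℝ (Fin d)) ρ, V x ≤ 5 / 9 * ‖x‖ ^ 2 := by
    intro x hx
    have := (abs_le.1 (hcube x hx)).2
    simp only [V]
    linarith
  have hint := integrableOn_exp_neg_of_growth hρd hD hVc hBD hg
  refine ⟨hint, fun A hA => ?_⟩
  have hlow := two_pow_le_setIntegral_closedBall hd hρd (hVc.mono hBD) hu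
  have hnum := (setIntegral_diff_closedBall_le hρd hD hint hg).trans hlt
  have hdisj := abs_tilted_sub_tilted_le hd hρ hη hηρ hL hW h1 h2 hA
  have hres : (volume.restrict D).restrict (Metric.closedBall 0 ρ) =
      volume.restrict (Metric.closedBall 0 ρ) := by
    rw [Measure.restrict_restrict hB, Set.inter_eq_left.2 hBD]
  have hresc : (volume.restrict D).restrict (Metric.closedBall 0 ρ)ᶜ =
      volume.restrict (D \ Metric.closedBall 0 ρ) := by
    rw [Measure.restrict_restrict hB.compl, Set.inter_comm, Set.sdiff_eq]
  have hBpos : 0 < ∫ x in Metric.closedBall 0 ρ, Real.exp (-V x) :=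
    lt_of_lt_of_le (by positivity) hlow
  have tail1 := abs_measureReal_tilted_sub_restrict_le (u := fun x => -V x) hint hB
    (by rwa [hres]) hA
  rw [hres, hresc] at tail1
  have hge : ∫ x in Metric.closedBall 0 ρ, Real.exp (-V x) ≤ ∫ x in D, Real.exp (-V x) :=
    setIntegral_mono_set hint (Filter.Eventually.of_forall fun _ => (Real.exp_pos _).le)
      hBD.eventuallyLE
  have tail1' : (∫ x in D \ Metric.closedBall 0 ρ, Real.exp (-V x)) / ∫ x in D, Real.exp (-V x) ≤
      2 * Real.exp (-(d * r ^ 2 / 9)) := by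
    rw [div_le_iff₀ (hBpos.trans_le hge)]
    exact hnum.trans (mul_le_mul_of_nonneg_left (hlow.trans hge) (by positivity))
  have ig : Integrable fun x : EuclideanSpace ℝ (Fin d) => Real.exp (-(‖x‖ ^ 2 / 2)) := by
    simpa only [exp_neg_sq_half] using integrable_exp_neg_mul_sq_norm (d := d) (by norm_num)
  have hne : NeZero (volume.restrict (Metric.closedBall (0 : EuclideanSpace ℝ (Fin d)) ρ)) := ⟨by
    rw [Ne, Measure.restrict_eq_zero]; exact (Metric.measure_closedBall_pos _ _ hρ).ne'⟩
  have tail2 := abs_measureReal_tilted_sub_restrict_le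
    (u := fun x : EuclideanSpace ℝ (Fin d) => -(‖x‖ ^ 2 / 2)) ig hB
    (integral_exp_pos ig.integrableOn) hA
  rw [← stdGaussian_eq_tilted] at tail2
  -- Triangle inequality through the two measures conditioned on the ball; the tails contribute `2 +
  -- 1 = 3` exponentials.
  have t1 := abs_le.1 (tail1.trans tail1')
  have t2 := abs_le.1 (tail2.trans hgt)
  have t3 := abs_le.1 hdisj
  exact abs_le.2 ⟨by linarith [t1.1, t2.2, t3.1], by linarith [t1.2, t2.1, t3.2]⟩

/-! ### Integrating derivative bounds along rays -/

theorem norm_le_of_norm_deriv_le_radial {E F : Type*} [NormedAddCommGroup E] [NormedSpace ℝ E]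
    [NormedAddCommGroup F] [NormedSpace ℝ F] {g : E → F} {g' : E → E →L[ℝ] F} {R c : ℝ} {k : ℕ}
    (hg : ∀ x ∈ Metric.ball 0 R, HasFDerivAt g (g' x) x)
    (hb : ∀ x ∈ Metric.ball 0 R, ‖g' x‖ ≤ c * ‖x‖ ^ k) (h0 : g 0 = 0) {x : E}
    (hx : x ∈ Metric.ball 0 R) : ‖g x‖ ≤ c * ‖x‖ ^ (k + 1) / (k + 1) := by
  have hmem : ∀ t ∈ Set.Icc (0 : ℝ) 1, t • x ∈ Metric.ball (0 : E) R := by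
    intro t ht
    rw [mem_ball_zero_iff] at hx ⊢
    rw [norm_smul, Real.norm_eq_abs, abs_of_nonneg ht.1]
    exact (mul_le_of_le_one_left (norm_nonneg _) ht.2).trans_lt hx
  have hder : ∀ t ∈ Set.Icc (0 : ℝ) 1,
      HasDerivAt (fun t : ℝ => g (t • x)) (g' (t • x) x) t := by
    intro t ht
    have h1 : HasDerivAt (fun t : ℝ => t • x) x t := by
      simpa using (hasDerivAt_id t).smul_const x
    exact (hg _ (hmem t ht)).comp_hasDerivAt t h1
  -- On the ray `t ↦ t x` the norm is compared with `c‖x‖^{k+1} t^{k+1}/(k+1)`, whose derivative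
  -- dominates that of `g`.
  have key := image_norm_le_of_norm_deriv_right_le_deriv_boundary
    (f := fun t : ℝ => g (t • x)) (f' := fun t => g' (t • x) x) (a := 0) (b := 1)
    (B := fun t => c * ‖x‖ ^ (k + 1) / (k + 1) * t ^ (k + 1))
    (B' := fun t => c * ‖x‖ ^ (k + 1) * t ^ k)
    (fun t ht => (hder t ht).continuousAt.continuousWithinAt)
    (fun t ht => (hder t (Set.Ico_subset_Icc_self ht)).hasDerivWithinAt)
    (by simp [h0])
    (fun t => by
      have := (hasDerivAt_pow (k + 1) t).const_mul (c * ‖x‖ ^ (k + 1) / (k + 1))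
      have hk : (k : ℝ) + 1 ≠ 0 := by positivity
      refine this.congr_deriv ?_
      rw [Nat.add_sub_cancel, ← mul_assoc]
      push_cast
      rw [div_mul_cancel₀ _ hk])
    (fun t ht => by
      have ht' := Set.Ico_subset_Icc_self ht
      refine ((g' (t • x)).le_opNorm x).trans ?_
      refine (mul_le_mul_of_nonneg_right (hb _ (hmem t ht')) (norm_nonneg x)).trans (le_of_eq ?_)
      rw [norm_smul, Real.norm_eq_abs, abs_of_nonneg ht.1]
      ring)
    (Set.right_mem_Icc.2 zero_le_one)
  simpa using key

/-! ### Hessian matrices and bilinear forms -/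

theorem bilin_eq_inner (b : EuclideanSpace ℝ (Fin d) →L[ℝ] EuclideanSpace ℝ (Fin d) →L[ℝ] ℝ)
    (x y : EuclideanSpace ℝ (Fin d)) :
    b x y = inner ℝ x (toEuclideanCLM (𝕜 := ℝ) (Matrix.of fun i j =>
      b (EuclideanSpace.single i 1) (EuclideanSpace.single j 1)) y) := by
  have ex : ∀ z : EuclideanSpace ℝ (Fin d), z = ∑ i, z i • EuclideanSpace.single i (1 : ℝ) := by
    intro z
    ext j
    simp [Finset.sum_apply, Pi.single_apply]
  rw [inner_toEuclideanCLM]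
  conv_lhs => rw [ex x, ex y]
  simp only [map_sum, map_smul, _root_.sum_apply, _root_.smul_apply,
    smul_eq_mul, dotProduct, mulVec, Matrix.of_apply]
  simp only [Finset.mul_sum]
  rw [Finset.sum_comm]
  refine Finset.sum_congr rfl fun i _ => ?_
  refine Finset.sum_congr rfl fun j _ => ?_
  ring

theorem fderiv_fderiv_apply {f : EuclideanSpace ℝ (Fin d) → ℝ}
    {Θ : Set (EuclideanSpace ℝ (Fin d))} (hC2 : ContDiffOn ℝ 2 f Θ) (hΘ : Convex ℝ Θ)
    {θ : EuclideanSpace ℝ (Fin d)} (hθ : θ ∈ interior Θ) (x y : EuclideanSpace ℝ (Fin d)) :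
    fderiv ℝ (fderiv ℝ f) θ x y = inner ℝ x (toEuclideanCLM (𝕜 := ℝ) (hessian f Θ θ) y) := by
  rw [bilin_eq_inner]
  congr 4
  ext i j
  -- Convexity with nonempty interior makes derivatives within `Θ` unique, so at interior points
  -- they are the ordinary ones.
  rw [iteratedFDerivWithin_eq_iteratedFDeriv (uniqueDiffOn_convex hΘ ⟨θ, hθ⟩)
    (hC2.contDiffAt (mem_interior_iff_mem_nhds.1 hθ)) (interior_subset hθ),
    iteratedFDeriv_two_apply]
  simp

/-! ### The standardizing matrix -/

section SqrtMatrix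

variable {H : Matrix (Fin d) (Fin d) ℝ}

theorem isUnit_sqrt (hH : H.PosDef) : IsUnit (CFC.sqrt H) :=
  (CFC.isUnit_sqrt_iff H hH.posSemidef.nonneg).2 hH.isUnit

theorem sqrt_mul_inv (hH : H.PosDef) : CFC.sqrt H * (CFC.sqrt H)⁻¹ = 1 :=
  Matrix.mul_nonsing_inv _ ((Matrix.isUnit_iff_isUnit_det _).1 (isUnit_sqrt hH))

theorem inv_mul_sqrt (hH : H.PosDef) : (CFC.sqrt H)⁻¹ * CFC.sqrt H = 1 :=
  Matrix.nonsing_inv_mul _ ((Matrix.isUnit_iff_isUnit_det _).1 (isUnit_sqrt hH))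

theorem inv_sqrt_mul_mul_inv_sqrt (hH : H.PosDef) :
    (CFC.sqrt H)⁻¹ * H * (CFC.sqrt H)⁻¹ = 1 := by
  have h := CFC.sqrt_mul_sqrt_self H hH.posSemidef.nonneg
  calc (CFC.sqrt H)⁻¹ * H * (CFC.sqrt H)⁻¹
      = (CFC.sqrt H)⁻¹ * (CFC.sqrt H * CFC.sqrt H) * (CFC.sqrt H)⁻¹ := by rw [h]
    _ = ((CFC.sqrt H)⁻¹ * CFC.sqrt H) * (CFC.sqrt H * (CFC.sqrt H)⁻¹) := by
        simp only [Matrix.mul_assoc]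
    _ = 1 := by rw [inv_mul_sqrt hH, sqrt_mul_inv hH, one_mul]

theorem posSemidef_inv_sqrt : ((CFC.sqrt H)⁻¹).PosSemidef :=
  (Matrix.nonneg_iff_posSemidef.1 (CFC.sqrt_nonneg H)).inv

theorem sqrt_inv_smul (hH : H.PosDef) {n : ℝ} (hn : 0 < n) :
    CFC.sqrt ((n • H)⁻¹) = (√n)⁻¹ • (CFC.sqrt H)⁻¹ := by
  refine CFC.sqrt_unique ?_ ?_
  · have h := CFC.sqrt_mul_sqrt_self H hH.posSemidef.nonneg
    symm
    refine Matrix.inv_eq_right_inv ?_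
    rw [smul_mul_smul_comm, ← mul_inv, Real.mul_self_sqrt hn.le, smul_mul_smul_comm,
      mul_inv_cancel₀ hn.ne', one_smul, ← Matrix.mul_inv_rev, h]
    exact Matrix.mul_nonsing_inv _ ((Matrix.isUnit_iff_isUnit_det _).1 hH.isUnit)
  · exact (posSemidef_inv_sqrt.smul (by positivity)).nonneg

theorem inner_inv_sqrt_comm (x y : EuclideanSpace ℝ (Fin d)) :
    inner ℝ (toEuclideanCLM (𝕜 := ℝ) (CFC.sqrt H)⁻¹ x) y =
      inner ℝ x (toEuclideanCLM (𝕜 := ℝ) (CFC.sqrt H)⁻¹ y) := by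
  have hsa : IsSelfAdjoint ((CFC.sqrt H)⁻¹) := posSemidef_inv_sqrt.isHermitian
  have := hsa.map (toEuclideanCLM (𝕜 := ℝ) (n := Fin d))
  rw [← ContinuousLinearMap.adjoint_inner_right, this.adjoint_eq]

theorem toEuclideanCLM_mul_apply (A B : Matrix (Fin d) (Fin d) ℝ) (x : EuclideanSpace ℝ (Fin d)) :
    toEuclideanCLM (𝕜 := ℝ) (A * B) x =
      toEuclideanCLM (𝕜 := ℝ) A (toEuclideanCLM (𝕜 := ℝ) B x) := by
  rw [map_mul]
  rfl

theorem inner_inv_sqrt_mul (S : Matrix (Fin d) (Fin d) ℝ) (x y : EuclideanSpace ℝ (Fin d)) :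
    inner ℝ (toEuclideanCLM (𝕜 := ℝ) (CFC.sqrt H)⁻¹ x)
      (toEuclideanCLM (𝕜 := ℝ) S (toEuclideanCLM (𝕜 := ℝ) (CFC.sqrt H)⁻¹ y)) =
    inner ℝ x (toEuclideanCLM (𝕜 := ℝ) ((CFC.sqrt H)⁻¹ * S * (CFC.sqrt H)⁻¹) y) := by
  rw [inner_inv_sqrt_comm, toEuclideanCLM_mul_apply, toEuclideanCLM_mul_apply]

/-- The linear part `x ↦ n^{-1/2} H^{-1/2} x` of the standardizing change of variables. -/
noncomputable def standardizer (hH : H.PosDef) {n : ℝ} (hn : 0 < n) :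
    EuclideanSpace ℝ (Fin d) ≃L[ℝ] EuclideanSpace ℝ (Fin d) :=
  ContinuousLinearEquiv.equivOfInverse
    ((√n)⁻¹ • toEuclideanCLM (𝕜 := ℝ) (CFC.sqrt H)⁻¹) (√n • toEuclideanCLM (𝕜 := ℝ) (CFC.sqrt H))
    (fun x => by
      have : √n ≠ 0 := (Real.sqrt_pos.2 hn).ne'
      simp only [_root_.smul_apply, map_smul, smul_smul,
        inv_mul_cancel₀ this, one_smul]
      rw [← toEuclideanCLM_mul_apply, sqrt_mul_inv hH, map_one]
      rfl)
    (fun x => by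
      have : √n ≠ 0 := (Real.sqrt_pos.2 hn).ne'
      simp only [_root_.smul_apply, map_smul, smul_smul, mul_inv_cancel₀ this,
        one_smul]
      rw [← toEuclideanCLM_mul_apply, inv_mul_sqrt hH, map_one]
      rfl)

theorem standardizer_apply (hH : H.PosDef) {n : ℝ} (hn : 0 < n) (x : EuclideanSpace ℝ (Fin d)) :
    standardizer hH hn x = (√n)⁻¹ • toEuclideanCLM (𝕜 := ℝ) (CFC.sqrt H)⁻¹ x := rfl

theorem vecNorm_standardizer (hH : H.PosDef) {n : ℝ} (hn : 0 < n)
    (x : EuclideanSpace ℝ (Fin d)) : vecNorm H (standardizer hH hn x) = ‖x‖ / √n := by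
  rw [vecNorm, standardizer_apply, map_smul, ← toEuclideanCLM_mul_apply, sqrt_mul_inv hH, map_one,
    norm_smul, Real.norm_eq_abs, abs_of_nonneg (by positivity), div_eq_inv_mul]
  rfl

/-- In standardized coordinates `n H` becomes the identity, so the difference is the bilinear form
of `H^{-1/2}(S-H)H^{-1/2}`, whose operator norm is the weighted norm of `S - H`. -/
theorem abs_inner_standardizer_sub_le (hH : H.PosDef) {n : ℝ} (hn : 0 < n)
    (S : Matrix (Fin d) (Fin d) ℝ) (x y : EuclideanSpace ℝ (Fin d)) :
    |n * inner ℝ (standardizer hH hn x) (toEuclideanCLM (𝕜 := ℝ) S (standardizer hH hn y)) -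
      inner ℝ x y| ≤ matNorm H (S - H) * ‖x‖ * ‖y‖ := by
  have e : n * inner ℝ (standardizer hH hn x)
      (toEuclideanCLM (𝕜 := ℝ) S (standardizer hH hn y)) - inner ℝ x y =
      inner ℝ x (toEuclideanCLM (𝕜 := ℝ) ((CFC.sqrt H)⁻¹ * (S - H) * (CFC.sqrt H)⁻¹) y) := by
    rw [standardizer_apply, standardizer_apply, map_smul, real_inner_smul_left,
      real_inner_smul_right, inner_inv_sqrt_mul, Matrix.mul_sub, Matrix.sub_mul,
      inv_sqrt_mul_mul_inv_sqrt hH, map_sub, map_one, _root_.sub_apply, inner_sub_right,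
      ← mul_assoc, ← mul_assoc, mul_assoc n, ← mul_inv, Real.mul_self_sqrt hn.le,
      mul_inv_cancel₀ hn.ne', one_mul]
    rfl
  rw [e, matNorm]
  refine (abs_real_inner_le_norm _ _).trans ?_
  have := mul_le_mul_of_nonneg_left (ContinuousLinearMap.le_opNorm
    (toEuclideanCLM (𝕜 := ℝ) ((CFC.sqrt H)⁻¹ * (S - H) * (CFC.sqrt H)⁻¹)) y) (norm_nonneg x)
  linarith

end SqrtMatrix

/-! ### Affine change of variables -/

/-- The Jacobian need only be nonzero and finite: it cancels when densities are normalized. -/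
theorem volume_map_affine (e : EuclideanSpace ℝ (Fin d) ≃L[ℝ] EuclideanSpace ℝ (Fin d))
    (c : EuclideanSpace ℝ (Fin d)) :
    ∃ a : ℝ≥0∞, a ≠ 0 ∧ a ≠ ∞ ∧
      Measure.map (fun x => c + e x) (volume : Measure (EuclideanSpace ℝ (Fin d))) =
        a • volume := by
  have hdet : LinearMap.det (e.toLinearEquiv : EuclideanSpace ℝ (Fin d) →ₗ[ℝ] _) ≠ 0 :=
    (LinearEquiv.isUnit_det' e.toLinearEquiv).ne_zero
  refine ⟨ENNReal.ofReal |(LinearMap.det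
    (e.toLinearEquiv : EuclideanSpace ℝ (Fin d) →ₗ[ℝ] _))⁻¹|, ?_, ENNReal.ofReal_ne_top, ?_⟩
  · rw [Ne, ENNReal.ofReal_eq_zero, not_le]
    exact abs_pos.2 (inv_ne_zero hdet)
  · have h := Measure.map_linearMap_addHaar_eq_smul_addHaar
      (volume : Measure (EuclideanSpace ℝ (Fin d))) hdet
    have h2 : Measure.map e (volume : Measure (EuclideanSpace ℝ (Fin d))) = _ := h
    have : (fun x => c + e x) = (fun x => c + x) ∘ e := rfl
    rw [this, ← Measure.map_map (measurable_const_add c) e.continuous.measurable, h2,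
      Measure.map_smul, map_add_left_eq_self]

/-- The affine homeomorphism `x ↦ c + e x`. -/
noncomputable def affineHomeomorph
    (e : EuclideanSpace ℝ (Fin d) ≃L[ℝ] EuclideanSpace ℝ (Fin d))
    (c : EuclideanSpace ℝ (Fin d)) : EuclideanSpace ℝ (Fin d) ≃ₜ EuclideanSpace ℝ (Fin d) :=
  e.toHomeomorph.trans (Homeomorph.addLeft c)

theorem affineHomeomorph_apply (e : EuclideanSpace ℝ (Fin d) ≃L[ℝ] EuclideanSpace ℝ (Fin d))
    (c x : EuclideanSpace ℝ (Fin d)) : affineHomeomorph e c x = c + e x := rfl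

section Affine

variable (e : EuclideanSpace ℝ (Fin d) ≃L[ℝ] EuclideanSpace ℝ (Fin d))
  (c : EuclideanSpace ℝ (Fin d)) (u : EuclideanSpace ℝ (Fin d) → ℝ)

theorem integrableOn_affine_iff (S : Set (EuclideanSpace ℝ (Fin d))) :
    IntegrableOn (fun x => u (affineHomeomorph e c x)) (affineHomeomorph e c ⁻¹' S) ↔
      IntegrableOn u S := by
  obtain ⟨a, ha0, ha1, ha⟩ := volume_map_affine e c
  have h := (affineHomeomorph e c).measurableEmbedding.integrableOn_map_iff (f := u)
    (μ := volume) (s := S)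
  have ha' : Measure.map (affineHomeomorph e c) volume = a • volume := ha
  rw [ha', IntegrableOn, Measure.restrict_smul, integrable_smul_measure ha0 ha1] at h
  exact h.symm

theorem measureReal_tilted_affine {Θ : Set (EuclideanSpace ℝ (Fin d))}
    {A : Set (EuclideanSpace ℝ (Fin d))} (hA : MeasurableSet A) :
    ((volume.restrict Θ).tilted u).real A =
      ((volume.restrict (affineHomeomorph e c ⁻¹' Θ)).tilted
        fun x => u (affineHomeomorph e c x)).real (affineHomeomorph e c ⁻¹' A) := by
  obtain ⟨a, ha0, ha1, ha⟩ := volume_map_affine e c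
  have ha' : Measure.map (affineHomeomorph e c) volume = a • volume := ha
  have key : ∀ S : Set (EuclideanSpace ℝ (Fin d)),
      ∫ x in affineHomeomorph e c ⁻¹' S, Real.exp (u (affineHomeomorph e c x)) =
        a.toReal * ∫ x in S, Real.exp (u x) := by
    intro S
    have h := (affineHomeomorph e c).measurableEmbedding.setIntegral_map (μ := volume)
      (fun x => Real.exp (u x)) S
    rw [← h, ha', Measure.restrict_smul, integral_smul_measure, smul_eq_mul]
  have hAm : MeasurableSet (affineHomeomorph e c ⁻¹' A) :=
    (affineHomeomorph e c).continuous.measurable hA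
  rw [measureReal_tilted _ hA, measureReal_tilted _ hAm, Measure.restrict_restrict hA,
    Measure.restrict_restrict hAm, ← Set.preimage_inter, key, key,
    mul_div_mul_left _ _ (ENNReal.toReal_ne_zero.2 ⟨ha0, ha1⟩)]

end Affine

theorem laplace_real_eq {f : EuclideanSpace ℝ (Fin d) → ℝ} {Θ : Set (EuclideanSpace ℝ (Fin d))}
    {c : EuclideanSpace ℝ (Fin d)} (hH : (hessian f Θ c).PosDef) {n : ℝ} (hn : 0 < n)
    {A : Set (EuclideanSpace ℝ (Fin d))} (hA : MeasurableSet A) :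
    (laplace f Θ c n).real A = (stdGaussian (EuclideanSpace ℝ (Fin d))).real
      (affineHomeomorph (standardizer hH hn) c ⁻¹' A) := by
  have e : (fun x => c + toEuclideanCLM (𝕜 := ℝ) (CFC.sqrt ((n • hessian f Θ c)⁻¹)) x) =
      affineHomeomorph (standardizer hH hn) c := by
    ext1 x
    rw [affineHomeomorph_apply, standardizer_apply, sqrt_inv_smul hH hn, map_smul]
    rfl
  rw [laplace, multivariateGaussian, e, measureReal_def, measureReal_def,
    Measure.map_apply (affineHomeomorph _ _).continuous.measurable hA]

/-- The inner product as a continuous bilinear form over `ℝ`. -/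
noncomputable def innerBilin (d : ℕ) :
    EuclideanSpace ℝ (Fin d) →L[ℝ] EuclideanSpace ℝ (Fin d) →L[ℝ] ℝ :=
  LinearMap.mkContinuous₂ (innerₗ (EuclideanSpace ℝ (Fin d))) 1 fun x y => by
    rw [one_mul]
    exact norm_inner_le_norm x y

theorem innerBilin_apply (x y : EuclideanSpace ℝ (Fin d)) :
    innerBilin d x y = inner ℝ x y := rfl

theorem hasFDerivAt_norm_sq_half (x : EuclideanSpace ℝ (Fin d)) :
    HasFDerivAt (fun x : EuclideanSpace ℝ (Fin d) => ‖x‖ ^ 2 / 2) (innerBilin d x) x := by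
  have h := (hasStrictFDerivAt_norm_sq x).hasFDerivAt.const_mul (1 / 2 : ℝ)
  have e : (fun x : EuclideanSpace ℝ (Fin d) => ‖x‖ ^ 2 / 2) = fun x => 1 / 2 * ‖x‖ ^ 2 := by
    ext1 x; ring
  rw [e]
  refine h.congr_fderiv ?_
  ext y
  simp [innerBilin_apply]

/-! ### The standardized remainder and its derivatives. -/

section ThirdOrder

variable {f : EuclideanSpace ℝ (Fin d) → ℝ} {Θ : Set (EuclideanSpace ℝ (Fin d))}
  {c : EuclideanSpace ℝ (Fin d)} {n r : ℝ}

theorem matNorm_le_delta3_mul (hδ : delta3 f Θ c n r ≠ ∞) {θ : EuclideanSpace ℝ (Fin d)}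
    (hθ : θ ∈ ball (hessian f Θ c) c n r) (h0 : 0 < vecNorm (hessian f Θ c) (θ - c)) :
    matNorm (hessian f Θ c) (hessian f Θ θ - hessian f Θ c) ≤
      (delta3 f Θ c n r).toReal * vecNorm (hessian f Θ c) (θ - c) := by
  have hne : θ ≠ c := by
    rintro rfl
    simp [vecNorm] at h0
  have hle : ENNReal.ofReal (matNorm (hessian f Θ c) (hessian f Θ θ - hessian f Θ c) /
      vecNorm (hessian f Θ c) (θ - c)) ≤ delta3 f Θ c n r :=
    le_iSup₂_of_le (f := fun θ (_ : θ ∈ ball (hessian f Θ c) c n r \ {c}) => ENNReal.ofReal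
      (matNorm (hessian f Θ c) (hessian f Θ θ - hessian f Θ c) /
        vecNorm (hessian f Θ c) (θ - c))) θ ⟨hθ, hne⟩ le_rfl
  rw [← div_le_iff₀ h0]
  exact (ENNReal.ofReal_le_iff_le_toReal hδ).1 hle

variable (hH : (hessian f Θ c).PosDef) (hn : 0 < n)

theorem mem_ball_affine_iff {x : EuclideanSpace ℝ (Fin d)} :
    affineHomeomorph (standardizer hH hn) c x ∈ ball (hessian f Θ c) c n r ↔ ‖x‖ ≤ r * √d := by
  rw [ball, Set.mem_ofPred_eq, affineHomeomorph_apply, add_sub_cancel_left,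
    vecNorm_standardizer, Real.sqrt_div (Nat.cast_nonneg d), ← mul_div_assoc,
    div_le_div_iff_of_pos_right (Real.sqrt_pos.2 hn)]

theorem matNorm_affine_le (hδ : delta3 f Θ c n r ≠ ∞) {x : EuclideanSpace ℝ (Fin d)}
    (hx : ‖x‖ ≤ r * √d) :
    matNorm (hessian f Θ c)
        (hessian f Θ (affineHomeomorph (standardizer hH hn) c x) - hessian f Θ c) ≤
      (delta3 f Θ c n r).toReal / √n * ‖x‖ := by
  -- The supremum defining `δ₃` omits the centre, where both sides vanish.
  by_cases h0 : x = 0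
  · subst h0
    simp [affineHomeomorph_apply, matNorm]
  · have hv : vecNorm (hessian f Θ c) (affineHomeomorph (standardizer hH hn) c x - c) =
        ‖x‖ / √n := by
      rw [affineHomeomorph_apply, add_sub_cancel_left, vecNorm_standardizer]
    have h := matNorm_le_delta3_mul hδ ((mem_ball_affine_iff hH hn).2 hx) (by
      rw [hv]
      exact div_pos (norm_pos_iff.2 h0) (Real.sqrt_pos.2 hn))
    rw [hv] at h
    refine h.trans (le_of_eq ?_)
    ring

theorem ball_subset_preimage_interior (hball : ball (hessian f Θ c) c n r ⊆ Θ) :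
    Metric.ball 0 (r * √d) ⊆ affineHomeomorph (standardizer hH hn) c ⁻¹' interior Θ := by
  rw [(affineHomeomorph (standardizer hH hn) c).preimage_interior]
  refine interior_maximal (fun x hx => hball ?_) Metric.isOpen_ball
  exact (mem_ball_affine_iff hH hn).2 (by simpa using (mem_ball_zero_iff.1 hx).le)

/-- The gradient of the standardized remainder `n (f (c + Lx) - f c) - |x|²/2`. -/
noncomputable def remainderDeriv (x : EuclideanSpace ℝ (Fin d)) :
    EuclideanSpace ℝ (Fin d) →L[ℝ] ℝ :=
  n • ((fderiv ℝ f (affineHomeomorph (standardizer hH hn) c x)).comp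
    (standardizer hH hn : EuclideanSpace ℝ (Fin d) →L[ℝ] EuclideanSpace ℝ (Fin d))) -
      innerBilin d x

/-- The second derivative of the standardized remainder. -/
noncomputable def remainderDerivTwo (x : EuclideanSpace ℝ (Fin d)) :
    EuclideanSpace ℝ (Fin d) →L[ℝ] EuclideanSpace ℝ (Fin d) →L[ℝ] ℝ :=
  n • (((ContinuousLinearMap.compL ℝ (EuclideanSpace ℝ (Fin d)) (EuclideanSpace ℝ (Fin d)) ℝ).flip
    (standardizer hH hn : EuclideanSpace ℝ (Fin d) →L[ℝ] EuclideanSpace ℝ (Fin d))).comp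
      ((fderiv ℝ (fderiv ℝ f) (affineHomeomorph (standardizer hH hn) c x)).comp
        (standardizer hH hn : EuclideanSpace ℝ (Fin d) →L[ℝ] EuclideanSpace ℝ (Fin d)))) -
      innerBilin d

theorem hasFDerivAt_affineHomeomorph
    (e : EuclideanSpace ℝ (Fin d) ≃L[ℝ] EuclideanSpace ℝ (Fin d))
    (c x : EuclideanSpace ℝ (Fin d)) :
    HasFDerivAt (affineHomeomorph e c)
      (e : EuclideanSpace ℝ (Fin d) →L[ℝ] EuclideanSpace ℝ (Fin d)) x :=
  (e.hasFDerivAt (x := x)).const_add c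

theorem hasFDerivAt_remainder (hC2 : ContDiffOn ℝ 2 f Θ) {x : EuclideanSpace ℝ (Fin d)}
    (hx : affineHomeomorph (standardizer hH hn) c x ∈ interior Θ) :
    HasFDerivAt (fun x => n * (f (affineHomeomorph (standardizer hH hn) c x) - f c) -
      ‖x‖ ^ 2 / 2) (remainderDeriv hH hn x) x := by
  have hd : DifferentiableAt ℝ f (affineHomeomorph (standardizer hH hn) c x) :=
    (hC2.contDiffAt (mem_interior_iff_mem_nhds.1 hx)).differentiableAt (by norm_num)
  exact (((hd.hasFDerivAt.comp x (hasFDerivAt_affineHomeomorph _ c x)).sub_const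
    (f c)).const_mul n).sub (hasFDerivAt_norm_sq_half x)

theorem hasFDerivAt_remainderDeriv (hC2 : ContDiffOn ℝ 2 f Θ) {x : EuclideanSpace ℝ (Fin d)}
    (hx : affineHomeomorph (standardizer hH hn) c x ∈ interior Θ) :
    HasFDerivAt (remainderDeriv hH hn) (remainderDerivTwo hH hn x) x := by
  have hd : DifferentiableAt ℝ (fderiv ℝ f) (affineHomeomorph (standardizer hH hn) c x) :=
    ((hC2.contDiffAt (mem_interior_iff_mem_nhds.1 hx)).fderiv_right (m := 1)
      (by norm_num)).differentiableAt (by norm_num)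
  have h1 := hd.hasFDerivAt.comp x (hasFDerivAt_affineHomeomorph _ c x)
  have h2 := (((ContinuousLinearMap.compL ℝ (EuclideanSpace ℝ (Fin d))
    (EuclideanSpace ℝ (Fin d)) ℝ).flip (standardizer hH hn :
      EuclideanSpace ℝ (Fin d) →L[ℝ] EuclideanSpace ℝ (Fin d))).hasFDerivAt.comp x h1)
  exact (h2.const_smul n).sub (innerBilin d).hasFDerivAt

theorem norm_remainderDerivTwo_le (hC2 : ContDiffOn ℝ 2 f Θ) (hΘ : Convex ℝ Θ) (hδ : delta3 f Θ c n r ≠ ∞)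
    {x : EuclideanSpace ℝ (Fin d)}
    (hx : affineHomeomorph (standardizer hH hn) c x ∈ interior Θ) (hxr : ‖x‖ ≤ r * √d) :
    ‖remainderDerivTwo hH hn x‖ ≤ (delta3 f Θ c n r).toReal / √n * ‖x‖ := by
  refine ContinuousLinearMap.opNorm_le_bound₂ _ (by positivity) fun u v => ?_
  have e : remainderDerivTwo hH hn x u v = n * inner ℝ (standardizer hH hn u)
      (toEuclideanCLM (𝕜 := ℝ) (hessian f Θ (affineHomeomorph (standardizer hH hn) c x))
        (standardizer hH hn v)) - inner ℝ u v := by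
    rw [← fderiv_fderiv_apply hC2 hΘ hx]
    rfl
  rw [e]
  refine (abs_inner_standardizer_sub_le hH hn _ u v).trans ?_
  gcongr
  exact matNorm_affine_le hH hn hδ hxr

end ThirdOrder

theorem standardized_convexOn {f : EuclideanSpace ℝ (Fin d) → ℝ}
    {Θ : Set (EuclideanSpace ℝ (Fin d))} (hf : ConvexOn ℝ Θ f)
    (e : EuclideanSpace ℝ (Fin d) ≃L[ℝ] EuclideanSpace ℝ (Fin d))
    (c : EuclideanSpace ℝ (Fin d)) {n : ℝ} (hn : 0 < n) (b : ℝ) :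
    ConvexOn ℝ (affineHomeomorph e c ⁻¹' Θ) fun x => n * (f (affineHomeomorph e c x) - b) := by
  have lin : ∀ (x y : EuclideanSpace ℝ (Fin d)) (s t : ℝ), s + t = 1 →
      affineHomeomorph e c (s • x + t • y) =
        s • affineHomeomorph e c x + t • affineHomeomorph e c y := by
    intro x y s t hst
    simp only [affineHomeomorph_apply, map_add, map_smul, smul_add]
    have : c = s • c + t • c := by rw [← add_smul, hst, one_smul]
    conv_lhs => rw [this]
    abel
  refine ⟨fun x hx y hy s t hs ht hst => ?_, fun x hx y hy s t hs ht hst => ?_⟩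
  · rw [Set.mem_preimage, lin x y s t hst]
    exact hf.1 hx hy hs ht hst
  · have h := mul_le_mul_of_nonneg_left (hf.2 hx hy hs ht hst) hn.le
    simp only [lin x y s t hst, smul_eq_mul] at h ⊢
    have : t = 1 - s := by linarith
    subst this
    linarith

/-! ### From standardized coordinates to the total variation bound. -/

theorem tvDist_le_of_forall {Ω : Type*} [MeasurableSpace Ω] {μ ν : Measure Ω} {b : ℝ}
    (h : ∀ A, MeasurableSet A → |μ.real A - ν.real A| ≤ b) : tvDist μ ν ≤ b := by
  have : Nonempty {A : Set Ω // MeasurableSet A} := ⟨⟨∅, MeasurableSet.empty⟩⟩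
  exact ciSup_le fun A => h A.1 A.2

theorem abs_measureReal_sub_le_one {Ω : Type*} [MeasurableSpace Ω] {μ ν : Measure Ω}
    [IsProbabilityMeasure μ] [IsProbabilityMeasure ν] (A : Set Ω) :
    |μ.real A - ν.real A| ≤ 1 := by
  have h1 : μ.real A ≤ 1 := measureReal_le_one
  have h2 : ν.real A ≤ 1 := measureReal_le_one
  have h3 : 0 ≤ μ.real A := measureReal_nonneg
  have h4 : 0 ≤ ν.real A := measureReal_nonneg
  exact abs_le.2 ⟨by linarith, by linarith⟩

/-- In dimension zero `δ₃` need not be controlled; the trivial bound for two probability measures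
suffices. -/
theorem bound_of_dim_zero {n : ℝ} {Θ : Set (EuclideanSpace ℝ (Fin 0))}
    {f : EuclideanSpace ℝ (Fin 0) → ℝ} {c : EuclideanSpace ℝ (Fin 0)} (hc : c ∈ Θ) :
    IntegrableOn (fun θ => Real.exp (-(n * f θ))) Θ ∧ IsProbabilityMeasure (gibbs f Θ n) ∧
      tvDist (gibbs f Θ n) (laplace f Θ c n) ≤ 1 := by
  have hΘ : Θ = Set.univ := Set.eq_univ_of_forall fun x => Subsingleton.elim c x ▸ hc
  have hvol : (volume : Measure (EuclideanSpace ℝ (Fin 0))) = Measure.dirac 0 :=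
    volume_euclideanSpace_eq_dirac _
  have hint : IntegrableOn (fun θ => Real.exp (-(n * f θ))) Θ := by
    rw [IntegrableOn, hΘ, Measure.restrict_univ, hvol]
    exact Integrable.of_finite
  have hne : NeZero ((volume : Measure (EuclideanSpace ℝ (Fin 0))).restrict Θ) := by
    rw [hΘ, Measure.restrict_univ, hvol]
    exact ⟨IsProbabilityMeasure.ne_zero _⟩
  have hg : IsProbabilityMeasure (gibbs f Θ n) := isProbabilityMeasure_tilted hint
  have hl : IsProbabilityMeasure (laplace f Θ c n) := by
    unfold laplace
    infer_instance
  exact ⟨hint, hg, tvDist_le_of_forall fun A _ => abs_measureReal_sub_le_one A⟩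

theorem bound_of_dim_pos (hd : 0 < d) {n : ℝ} (hn : 0 < n)
    {Θ : Set (EuclideanSpace ℝ (Fin d))} {f : EuclideanSpace ℝ (Fin d) → ℝ}
    (hC2 : ContDiffOn ℝ 2 f Θ) (hconv : ConvexOn ℝ Θ f)
    {c : EuclideanSpace ℝ (Fin d)} (hmin : ∀ θ ∈ Θ, f c ≤ f θ)
    (hH : (hessian f Θ c).PosDef) {r : ℝ} (hr : 6 ≤ r)
    (hball : ball (hessian f Θ c) c n r ⊆ Θ)
    (hδ : ENNReal.ofReal r * delta3 f Θ c n r * ENNReal.ofReal (√((d : ℝ) / n)) ≤ 1 / 2) :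
    IntegrableOn (fun θ => Real.exp (-(n * f θ))) Θ ∧ IsProbabilityMeasure (gibbs f Θ n) ∧
      tvDist (gibbs f Θ n) (laplace f Θ c n) ≤
        (delta3 f Θ c n r).toReal * (d : ℝ) / √(2 * n) +
          3 * Real.exp (-((d : ℝ) * r ^ 2 / 9)) := by
  have hd' : (0 : ℝ) < d := by exact_mod_cast hd
  have hr0 : 0 < r := by linarith
  have hsn : 0 < √n := Real.sqrt_pos.2 hn
  have hsd : 0 < √(d : ℝ) := Real.sqrt_pos.2 hd'
  have hR : 0 < r * √d := by positivity
  -- With `d, r > 0` an infinite `δ₃` would make the product infinite, so passing to a real number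
  -- loses nothing.
  have hδtop : delta3 f Θ c n r ≠ ∞ := by
    intro h
    have hdn : ENNReal.ofReal √((d : ℝ) / n) ≠ 0 := by
      simpa only [Ne, ENNReal.ofReal_eq_zero, not_le] using Real.sqrt_pos.2 (div_pos hd' hn)
    rw [h, ENNReal.mul_top (by simpa using hr0), ENNReal.top_mul hdn] at hδ
    simp at hδ
  set δ := (delta3 f Θ c n r).toReal
  have hδ0 : 0 ≤ δ := ENNReal.toReal_nonneg
  have hηR : δ / √n * (r * √d) ≤ 1 / 2 := by
    have h := ENNReal.toReal_mono (by simp) hδ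
    rw [ENNReal.toReal_mul, ENNReal.toReal_mul, ENNReal.toReal_ofReal hr0.le,
      ENNReal.toReal_ofReal (Real.sqrt_nonneg _), Real.sqrt_div hd'.le] at h
    have e : r * δ * (√d / √n) = δ / √n * (r * √d) := by ring
    rw [← e]
    simpa using h
  set T := affineHomeomorph (standardizer hH hn) c
  set D := T ⁻¹' interior Θ
  have hTint : Metric.ball 0 (r * √d) ⊆ D := ball_subset_preimage_interior hH hn hball
  have hT0 : T 0 = c := by simp [T, affineHomeomorph_apply]
  have hcint : c ∈ interior Θ := by
    have : (0 : EuclideanSpace ℝ (Fin d)) ∈ D := hTint (by simpa using hR)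
    simpa only [D, Set.mem_preimage, hT0] using this
  set W : EuclideanSpace ℝ (Fin d) → ℝ := fun x => n * (f (T x) - f c) - ‖x‖ ^ 2 / 2
  -- The ellipsoid may touch the boundary of `Θ`; the smaller closed ball stays where `W` is
  -- differentiable in the ordinary sense.
  have hsub : Metric.closedBall (0 : EuclideanSpace ℝ (Fin d)) (2 / 3 * (r * √d)) ⊆
      Metric.ball 0 (r * √d) := Metric.closedBall_subset_ball (by linarith)
  have hW : ∀ x ∈ Metric.ball 0 (r * √d), HasFDerivAt W (remainderDeriv hH hn x) x :=
    fun x hx => hasFDerivAt_remainder hH hn hC2 (hTint hx)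
  have hW' : ∀ x ∈ Metric.ball 0 (r * √d),
      HasFDerivAt (remainderDeriv hH hn) (remainderDerivTwo hH hn x) x :=
    fun x hx => hasFDerivAt_remainderDeriv hH hn hC2 (hTint hx)
  have hW'' : ∀ x ∈ Metric.ball 0 (r * √d), ‖remainderDerivTwo hH hn x‖ ≤ δ / √n * ‖x‖ :=
    fun x hx => norm_remainderDerivTwo_le hH hn hC2 hconv.1 hδtop (hTint hx)
      (mem_ball_zero_iff.1 hx).le
  have hgrad : remainderDeriv hH hn 0 = 0 := by
    have : IsLocalMin f c := by
      filter_upwards [mem_interior_iff_mem_nhds.1 hcint] with θ hθ using hmin θ hθ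
    have h0 := this.fderiv_eq_zero
    simp only [remainderDeriv]
    rw [show affineHomeomorph (standardizer hH hn) c 0 = c from hT0, h0]
    simp
  have hW0 : W 0 = 0 := by simp [W, hT0]
  have h1 : ∀ x ∈ Metric.ball 0 (r * √d), ‖remainderDeriv hH hn x‖ ≤ δ / √n * ‖x‖ ^ 2 / 2 := by
    intro x hx
    have := norm_le_of_norm_deriv_le_radial (k := 1) hW' (by simpa using hW'') hgrad hx
    norm_num at this ⊢
    exact this
  have h0 : ∀ x ∈ Metric.ball 0 (r * √d), |W x| ≤ δ / √n * ‖x‖ ^ 3 / 6 := by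
    intro x hx
    have := norm_le_of_norm_deriv_le_radial (k := 2) (c := δ / √n / 2) hW
      (fun y hy => (h1 y hy).trans (le_of_eq (by ring))) hW0 hx
    rw [Real.norm_eq_abs] at this
    refine this.trans (le_of_eq ?_)
    norm_num
    ring
  -- Any finite Lipschitz constant would do, since it does not enter the final bound.
  have h2 : ∀ x ∈ Metric.closedBall 0 (2 / 3 * (r * √d)),
      ∀ y ∈ Metric.closedBall 0 (2 / 3 * (r * √d)),
      ‖remainderDeriv hH hn x - remainderDeriv hH hn y‖ ≤ 1 / 2 * ‖x - y‖ := by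
    intro x hx y hy
    refine (convex_closedBall (0 : EuclideanSpace ℝ (Fin d))
      (2 / 3 * (r * √d))).norm_image_sub_le_of_norm_hasFDerivWithin_le
      (fun z hz => (hW' z (hsub hz)).hasFDerivWithinAt) (fun z hz => ?_) hy hx
    refine (hW'' z (hsub hz)).trans (le_trans ?_ hηR)
    exact mul_le_mul_of_nonneg_left (mem_ball_zero_iff.1 (hsub hz)).le (by positivity)
  have hV : (fun x => ‖x‖ ^ 2 / 2 + W x) = fun x => n * (f (T x) - f c) := by
    ext1 x
    simp only [W]
    ring
  have hVconv : ConvexOn ℝ D fun x => ‖x‖ ^ 2 / 2 + W x := by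
    rw [hV]
    exact standardized_convexOn (hconv.subset interior_subset hconv.1.interior) _ c hn _
  have hfc : ContinuousOn f Θ := hC2.continuousOn
  have hWc : ContinuousOn W D := by
    have : ContinuousOn (fun x => f (T x)) D :=
      hfc.comp T.continuous.continuousOn fun x hx => interior_subset hx
    exact (continuousOn_const.mul (this.sub continuousOn_const)).sub (by fun_prop)
  have hD : MeasurableSet D := (isOpen_interior.preimage T.continuous).measurableSet
  obtain ⟨hint, hbound⟩ := standardized_bound hd hr (by positivity) hηR (by norm_num) hD
    (hsub.trans hTint) hVconv hWc (fun x hx => hW x (hsub hx)) (fun x hx => h0 x (hsub hx))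
    (fun x hx => h1 x (hsub hx)) h2
  -- The frontier of a convex set is Lebesgue-null, so `Θ`, which is not assumed measurable, may be
  -- replaced by its interior.
  have hae : volume.restrict Θ = volume.restrict (interior Θ) :=
    Measure.restrict_congr_set
      (interior_ae_eq_of_null_frontier (hconv.1.addHaar_frontier volume)).symm
  have hshift : ∀ x, Real.exp (-(‖x‖ ^ 2 / 2 + W x)) =
      Real.exp (n * f c) * Real.exp (-(n * f (T x))) := by
    intro x
    rw [congrFun hV x, ← Real.exp_add]
    ring_nf
  have hint' : IntegrableOn (fun θ => Real.exp (-(n * f θ))) Θ := by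
    rw [IntegrableOn, hae]
    refine (integrableOn_affine_iff (standardizer hH hn) c
      (fun θ => Real.exp (-(n * f θ))) (interior Θ)).1 ?_
    simp_rw [hshift] at hint
    exact (integrable_const_mul_iff (Real.exp_pos _).ne'.isUnit _).1 hint
  have hne : NeZero (volume.restrict Θ) := ⟨by
    rw [hae, Ne, Measure.restrict_eq_zero]
    exact (isOpen_interior.measure_pos volume ⟨c, hcint⟩).ne'⟩
  refine ⟨hint', isProbabilityMeasure_tilted hint', tvDist_le_of_forall fun A hA => ?_⟩
  -- The constant factor `e^{n f(c)}` cancels in the normalization.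
  have htilt : (volume.restrict D).tilted (fun x => -(n * f (T x))) =
      (volume.restrict D).tilted fun x => -(‖x‖ ^ 2 / 2 + W x) := by
    simp only [Measure.tilted]
    congr 1
    ext1 x
    simp_rw [hshift]
    rw [integral_const_mul, mul_div_mul_left _ _ (Real.exp_pos _).ne']
  have hb := hbound (T ⁻¹' A) (T.continuous.measurable hA)
  rw [gibbs, hae, measureReal_tilted_affine (standardizer hH hn) c _ hA, laplace_real_eq hH hn hA]
  change |((volume.restrict D).tilted (fun x => -(n * f (T x)))).real (T ⁻¹' A) - _| ≤ _
  rw [htilt]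
  refine hb.trans (le_of_eq ?_)
  rw [Real.sqrt_mul (by norm_num)]
  congr 1
  field_simp

end LaplaceApprox

theorem theorem2p1 (d : ℕ) (n : ℝ) (hn : 0 < n)
    (Θ : Set (EuclideanSpace ℝ (Fin d))) (f : EuclideanSpace ℝ (Fin d) → ℝ)
    (hC2 : ContDiffOn ℝ 2 f Θ) (hconv : ConvexOn ℝ Θ f)
    (θhat : EuclideanSpace ℝ (Fin d)) (hmem : θhat ∈ Θ)
    (hmin : ∀ θ ∈ Θ, θ ≠ θhat → f θhat < f θ)
    (hH : (LaplaceApprox.hessian f Θ θhat).PosDef)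
    (r : ℝ) (hr : 6 ≤ r)
    (hball : LaplaceApprox.ball (LaplaceApprox.hessian f Θ θhat) θhat n r ⊆ Θ)
    (hδ : ENNReal.ofReal r * LaplaceApprox.delta3 f Θ θhat n r * ENNReal.ofReal (√((d : ℝ) / n))
      ≤ 1 / 2) :
    IntegrableOn (fun θ => Real.exp (-(n * f θ))) Θ ∧
      IsProbabilityMeasure (LaplaceApprox.gibbs f Θ n) ∧
      LaplaceApprox.tvDist (LaplaceApprox.gibbs f Θ n) (LaplaceApprox.laplace f Θ θhat n) ≤
        (LaplaceApprox.delta3 f Θ θhat n r).toReal * (d : ℝ) / √(2 * n)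
          + 3 * Real.exp (-((d : ℝ) * r ^ 2 / 9)) := by
  rcases Nat.eq_zero_or_pos d with rfl | hd
  · obtain ⟨h1, h2, h3⟩ := LaplaceApprox.bound_of_dim_zero (n := n) (f := f) hmem
    refine ⟨h1, h2, h3.trans ?_⟩
    -- For `d = 0` the right side equals `3`.
    norm_num
  · refine LaplaceApprox.bound_of_dim_pos hd hn hC2 hconv (fun θ hθ => ?_) hH hr hball hδ
    rcases eq_or_ne θ θhat with rfl | hne
    · exact le_rfl
    · exact (hmin θ hθ hne).le
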